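/- Let $d,m\in\mathbb N$, $0<s<m$, $S\in\mathbb R$ and $\delta\ge 0$. There is a constant $C$, depending only on $d,m,s,S,\delta$, such that the following holds. Let $\mathbb T=\mathbb R/\mathbb Z$, and let $\psi\in L_2(\mathbb R)$ be a real-valued function such that * (support) $\operatorname{supp}\psi=[0,S]$; * (vanishing moments of order $m$) $\int_{\mathbb R}\psi(x)x^\beta\,\mathrm dx=0$ for $\beta=0,\dots,m-1$; * (Riesz basis on every level) with some $\gamma>0$, for all $j\ge 0$ and all $c_0,\dots,c_{2^j-1}\in\mathbb C$, $$\gamma\sum_{k=0}^{2^j-1}|c_k|^2\le\Big\|\sum_{k=0}^{2^j-1}c_k\psi^{\mathrm{per}}_{j,k}\Big\|_{L_2(\mathbb T)}^2\le\delta\sum_{k=0}^{2^j-1}|c_k|^2 ,$$ where $\psi^{\mathrm{per}}_{j,k}(x)=\sum_{\ell\in\mathbb Z}2^{j/2}\psi(2^j(x+\ell)-k)$ for $j\ge 0$, and $\psi^{\mathrm{per}}_{-1,0}=1$. For $\boldsymbol j\in\{-1,0,1,\dots\}^d$ put $|\boldsymbol j|_1=\sum_{i:\,j_i\ge 0}j_i$,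 $\mathcal I_{\boldsymbol j}=\times_{i=1}^d\mathcal I_{j_i}$ with $\mathcal I_j=\{0,\dots,2^j-1\}$ for $j\ge0$ and $\mathcal I_{-1}=\{0\}$, and $\psi^{\mathrm{per}}_{\boldsymbol j,\boldsymbol k}(\boldsymbol x)=\prod_{i=1}^d\psi^{\mathrm{per}}_{j_i,k_i}(x_i)$. Then for every $f\in L_2(\mathbb T^d)$ $$\Big(\sum_{\boldsymbol j\ge-\boldsymbol 1}2^{2|\boldsymbol j|_1s}\sum_{\boldsymbol k\in\mathcal I_{\boldsymbol j}}|\langle f,\psi^{\mathrm{per}}_{\boldsymbol j,\boldsymbol k}\rangle|^2\Big)^{1/2}\le C\,\|f\|_{H^s_{\mathrm{mix}}(\mathbb T^d)}$$ and $$\sup_{\boldsymbol j\ge-\boldsymbol 1}2^{|\boldsymbol j|_1s}\Big(\sum_{\boldsymbol k\in\mathcal I_{\boldsymbol j}}|\langle f,\psi^{\mathrm{per}}_{\boldsymbol j,\boldsymbol k}\rangle|^2\Big)^{1/2}\le C\,\|f\|_{\boldsymbol B^s_{2,\infty}(\mathbb T^d)} .$$ Here the right-hand sides may be infinite, $\langle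 f,g\rangle=\int_{\mathbb T^d}f\overline g$, and, with the Fourier coefficients $c_{\boldsymbol k}(f)=\int_{\mathbb T^d}f(\boldsymbol x)e^{-2\pi\mathrm i\langle\boldsymbol k,\boldsymbol x\rangle}\,\mathrm d\boldsymbol x$, $$\|f\|_{H^s_{\mathrm{mix}}(\mathbb T^d)}^2=\sum_{\boldsymbol k\in\mathbb Z^d}|c_{\boldsymbol k}(f)|^2\prod_{i=1}^d(1+|k_i|^2)^s,$$ $$\|f\|_{\boldsymbol B^s_{2,\infty}(\mathbb T^d)}=\sum_{u\subseteq\{1,\dots,d\}}\ \sup_{0<|h_i|\le1,\ i\in u}\Big(\prod_{i\in u}|h_i|^{-s}\Big)\big\|\Delta^{r,u}_{\boldsymbol h}f\big\|_{L_2(\mathbb T^d)},$$ where $r>s$ is any fixed integer ($C$ does not depend on $r$), $\Delta^{r,u}_{\boldsymbol h}=\prod_{i\in u}\Delta^r_{h_i,i}$ ($\Delta^{r,\varnothing}_{\boldsymbol h}=\mathrm{Id}$), and $\Delta^r_{h,i}f(\boldsymbol x)=\sum_{l=0}^r(-1)^{r-l}\binom rl f(\boldsymbol x+l h\boldsymbol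 e_i)$. -/

import Mathlib

open MeasureTheory
open scoped NNReal ENNReal

noncomputable section

namespace PeriodicWavelet

/-- Lebesgue measure on the torus `𝕋 = ℝ / ℤ`, of total mass one. -/
abbrev circleMeasure : Measure UnitAddCircle := AddCircle.haarAddCircle

/-- Lebesgue measure on `𝕋^d`, of total mass one. -/
abbrev torusMeasure (d : ℕ) : Measure (UnitAddTorus (Fin d)) :=
  Measure.pi fun _ => circleMeasure

/-! ### Wavelets on the line and their periodizations -/

/-- The dilates and translates `ψ_{j,k}(x) = 2^{j/2} ψ(2^j x - k)`. -/
def dilate (ψ : ℝ → ℝ) (j k : ℤ) (x : ℝ) : ℝ :=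
  (2 : ℝ) ^ ((j : ℝ) / 2) * ψ ((2 : ℝ) ^ j * x - (k : ℝ))

lemma periodic_tsum (g : ℝ → ℝ) :
    Function.Periodic (fun x : ℝ => ∑' l : ℤ, g (x + (l : ℝ))) 1 := by
  intro x
  have h := (Equiv.addLeft (1 : ℤ)).tsum_eq (fun l : ℤ => g (x + (l : ℝ)))
  simp only [Equiv.coe_addLeft, Int.cast_add, Int.cast_one] at h
  simpa [add_assoc] using h

/-- The periodization `x ↦ ∑_{l ∈ ℤ} g (x + l)`, as a function on `𝕋`. -/
def periodize (g : ℝ → ℝ) : UnitAddCircle → ℝ := (periodic_tsum g).lift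

/-- The univariate periodized wavelets `ψ^per_{j,k}`, `j ≥ -1`. On level `j = -1` this is the
periodized scaling function, the constant function one. -/
def psiPer (ψ : ℝ → ℝ) (j k : ℤ) : UnitAddCircle → ℝ :=
  if 0 ≤ j then periodize (dilate ψ j k) else fun _ => 1

/-- The univariate index set: `{0, …, 2^j - 1}` if `j ≥ 0`, and `{0}` if `j = -1`. -/
def idx (j : ℤ) : Finset ℤ := if 0 ≤ j then Finset.Ico 0 (2 ^ j.toNat) else {0}

/-- The multivariate index set `𝓘_j = ×_i 𝓘_{j_i}`. -/
def multiIdx {d : ℕ} (j : Fin d → ℤ) : Finset (Fin d → ℤ) :=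
  Fintype.piFinset fun i => idx (j i)

/-- The tensor product wavelets `ψ^per_{j,k}(x) = ∏_i ψ^per_{j_i,k_i}(x_i)`. -/
def multiPsiPer {d : ℕ} (ψ : ℝ → ℝ) (j k : Fin d → ℤ) (x : UnitAddTorus (Fin d)) : ℝ :=
  ∏ i, psiPer ψ (j i) (k i) (x i)

/-- The levels `j ∈ ℤ^d` with `j ≥ -1` componentwise. -/
abbrev Level (d : ℕ) : Type := {j : Fin d → ℤ // ∀ i, -1 ≤ j i}

/-- `|j|₁ = ∑_{i, j_i ≥ 0} j_i`. -/
def levelNorm {d : ℕ} (j : Fin d → ℤ) : ℤ := ∑ i with 0 ≤ j i, j i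

/-! ### The properties of the wavelet -/

/-- The support of `ψ` is the interval `[0, S]`. -/
def HasSupport (ψ : ℝ → ℝ) (S : ℝ) : Prop := tsupport ψ = Set.Icc 0 S

/-- Vanishing moments of order `m`. -/
def HasVanishingMoments (ψ : ℝ → ℝ) (m : ℕ) : Prop :=
  ∀ β < m, ∫ x : ℝ, ψ x * x ^ β = 0

/-- On every level `j ≥ 0` the periodized wavelets form a Riesz basis (of their span), with
constants `0 < γ` and `δ` that do not depend on `j`. -/
def IsRieszOnLevels (ψ : ℝ → ℝ) (γ δ : ℝ≥0) : Prop :=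
  0 < γ ∧ ∀ (j : ℤ), 0 ≤ j → ∀ c : ℤ → ℂ,
    (γ : ℝ≥0∞) * ∑ k ∈ idx j, ‖c k‖ₑ ^ 2 ≤
        eLpNorm (fun x => ∑ k ∈ idx j, c k * (psiPer ψ j k x : ℂ)) 2 circleMeasure ^ 2 ∧
      eLpNorm (fun x => ∑ k ∈ idx j, c k * (psiPer ψ j k x : ℂ)) 2 circleMeasure ^ 2 ≤
        (δ : ℝ≥0∞) * ∑ k ∈ idx j, ‖c k‖ₑ ^ 2

/-! ### Coefficients and function space norms -/

/-- The inner product `⟨f, g⟩ = ∫_{𝕋^d} f(x) conj(g(x)) dx`. -/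
def torusInner {d : ℕ} (f g : UnitAddTorus (Fin d) → ℂ) : ℂ :=
  ∫ x, f x * (starRingEnd ℂ) (g x) ∂(torusMeasure d)

/-- The primal wavelet coefficient `⟨f, ψ^per_{j,k}⟩`. -/
def coeff {d : ℕ} (ψ : ℝ → ℝ) (f : UnitAddTorus (Fin d) → ℂ) (j k : Fin d → ℤ) : ℂ :=
  torusInner f fun x => (multiPsiPer ψ j k x : ℂ)

/-- `‖f‖_{H^s_mix(𝕋^d)} = (∑_{k ∈ ℤ^d} |c_k(f)|^2 ∏_i (1 + |k_i|^2)^s)^{1/2}`, in `[0, ∞]`. -/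
def sobolevMixNorm {d : ℕ} (s : ℝ) (f : UnitAddTorus (Fin d) → ℂ) : ℝ≥0∞ :=
  (∑' k : Fin d → ℤ, ‖UnitAddTorus.mFourierCoeff f k‖ₑ ^ 2 *
    ∏ i, ENNReal.ofReal ((1 + (k i : ℝ) ^ 2) ^ s)) ^ (1 / 2 : ℝ)

/-- The `r`-th difference `Δ^r_{h,i}` with step `h` applied to the `i`-th coordinate. -/
def coordDiff {d : ℕ} (r : ℕ) (h : ℝ) (i : Fin d) (f : UnitAddTorus (Fin d) → ℂ) :
    UnitAddTorus (Fin d) → ℂ := fun x =>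
  ∑ l ∈ Finset.range (r + 1), (-1 : ℂ) ^ (r - l) * (r.choose l : ℂ) *
    f (Function.update x i (x i + (((l : ℝ) * h : ℝ) : UnitAddCircle)))

/-- The mixed difference `Δ^{r,u}_h = ∏_{i ∈ u} Δ^r_{h_i,i}`. The factors commute; they are
composed in the order of the coordinates. For `u = ∅` it is the identity. -/
def mixedDiff {d : ℕ} (r : ℕ) (u : Finset (Fin d)) (h : Fin d → ℝ)
    (f : UnitAddTorus (Fin d) → ℂ) : UnitAddTorus (Fin d) → ℂ :=
  u.sort.foldr (fun i g => coordDiff r (h i) i g) f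

/-- The seminorm `|f|_{B^s_{2,∞}(u)}`, in `[0, ∞]`, formed with differences of order `r`. -/
def besovSeminorm {d : ℕ} (r : ℕ) (s : ℝ) (u : Finset (Fin d))
    (f : UnitAddTorus (Fin d) → ℂ) : ℝ≥0∞ :=
  ⨆ (h : Fin d → ℝ) (_ : ∀ i ∈ u, 0 < |h i| ∧ |h i| ≤ 1),
    ENNReal.ofReal (∏ i ∈ u, |h i| ^ (-s)) * eLpNorm (mixedDiff r u h f) 2 (torusMeasure d)

/-- `‖f‖_{B^s_{2,∞}(𝕋^d)} = ∑_{u ⊆ {1,…,d}} |f|_{B^s_{2,∞}(u)}`, in `[0, ∞]`. -/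
def besovMixNorm {d : ℕ} (r : ℕ) (s : ℝ) (f : UnitAddTorus (Fin d) → ℂ) : ℝ≥0∞ :=
  ∑ u : Finset (Fin d), besovSeminorm r s u f

end PeriodicWavelet

end

noncomputable section

namespace PeriodicWavelet

/-! ### Periodization of compactly supported functions -/

/-! By Parseval, `coeff ψ f j k` pairs the Fourier coefficients of `f` with those of the wavelet, so
the matrices `waveletHat ψ j k ξ`, with rows `k ∈ idx j`, decide everything. In one variable and on
level `j ≥ 0` there are two regimes. For `|ξ| ≥ 2^j` the upper Riesz bound, dualized, bounds the
matrix by `δ`. For `|ξ| < 2^j` frequencies of one sign are incongruent modulo `2^j`, so their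
columns are orthogonal, with squared norms `|ψ^(ξ/2^j)|²`; the vanishing moments make these
`O(|ξ/2^j|^(2m))`, with a constant controlled by `S` and the `L₁`-norm of `ψ`, hence by `S` and `δ`
(`integral_abs_le`). Together this is `sum_sq_analysis_le_weight`: up to a constant, the dyadic
block `n ≥ 0` is damped by `min(1, 2^(2m(n+1-j)))`. Such weighted `ℓ²` bounds tensorize
(`sum_sq_tensor_le`), which gives `sum_sq_coeff_le` in `d` variables.

It remains to sum. The weight `2^(2js)` times the damping is at most `2^(2ns)` times a kernel in `j
- n` that decays geometrically in both directions because `0 < s < m`. Summing over the levels gives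
the Sobolev estimate; summing over the blocks at a fixed level gives the Besov estimate. For the
latter, `levelWeight_mul_block_le` bounds the energy of one block by a mixed difference whose
Fourier multiplier has modulus at least one there. This holds for every order `r`, so the constant
is independent of `r`. -/

lemma exists_finset_periodize {g : ℝ → ℝ} (hg : HasCompactSupport g) :
    ∃ L : Finset ℤ, ∀ x ∈ Set.Icc (0 : ℝ) 1, ∀ l ∉ L, g (x + (l : ℝ)) = 0 := by
  obtain ⟨R, hR⟩ := hg.isCompact.isBounded.subset_closedBall (0 : ℝ)
  refine ⟨Finset.Icc (⌊-R - 1⌋) (⌈R⌉), fun x hx l hl => ?_⟩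
  by_contra hne
  have h1 : x + (l : ℝ) ∈ Metric.closedBall (0 : ℝ) R := hR (subset_tsupport _ hne)
  rw [Real.closedBall_eq_Icc, zero_sub, zero_add] at h1
  apply hl
  rw [Finset.mem_Icc]
  constructor
  · have : ((⌊-R - 1⌋ : ℤ) : ℝ) ≤ l := (Int.floor_le _).trans (by linarith [h1.1, hx.2])
    exact_mod_cast this
  · have : (l : ℝ) ≤ (⌈R⌉ : ℤ) := le_trans (by linarith [h1.2, hx.1]) (Int.le_ceil _)
    exact_mod_cast this

lemma periodize_coe (g : ℝ → ℝ) (x : ℝ) :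
    periodize g (x : UnitAddCircle) = ∑' l : ℤ, g (x + (l : ℝ)) :=
  (periodic_tsum g).lift_coe x

lemma volume_eq_circleMeasure : (volume : Measure UnitAddCircle) = circleMeasure := by
  rw [AddCircle.volume_eq_smul_haarAddCircle]
  simp

lemma memLp_periodize {g : ℝ → ℝ} (hg : HasCompactSupport g) (hg2 : MemLp g 2 volume) :
    MemLp (fun x => (periodize g x : ℂ)) 2 circleMeasure := by
  obtain ⟨L, hL⟩ := exists_finset_periodize hg
  have hsum : MemLp (fun x : ℝ => ∑ l ∈ L, g (x + (l : ℝ))) 2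
      (volume.restrict (Set.Ioc (0 : ℝ) (0 + 1))) := by
    refine MemLp.restrict _ ?_
    refine memLp_finsetSum L fun l _ => ?_
    exact hg2.comp_measurePreserving (measurePreserving_add_right volume (l : ℝ))
  have h := MeasureTheory.MemLp.memLp_liftIoc (T := 1) (t := 0) (hsum.ofReal (K := ℂ))
  rw [volume_eq_circleMeasure] at h
  suffices heq : (fun x => (periodize g x : ℂ)) =
      AddCircle.liftIoc 1 0 fun x : ℝ => ((∑ l ∈ L, g (x + (l : ℝ)) : ℝ) : ℂ) from heq ▸ h
  funext x
  obtain ⟨y, hy, rfl⟩ : ∃ y ∈ Set.Ioc (0 : ℝ) (0 + 1), (y : UnitAddCircle) = x :=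
    ⟨_, (AddCircle.equivIoc 1 0 x).2, (AddCircle.equivIoc 1 0).symm_apply_apply x⟩
  rw [AddCircle.liftIoc_coe_apply hy, periodize_coe, tsum_eq_sum (s := L)]
  exact fun l hl => hL y ⟨hy.1.le, by linarith [hy.2]⟩ l hl

/-- The Fourier coefficients of a periodization are values of the Fourier transform. -/
lemma fourierCoeff_periodize {g : ℝ → ℝ} (hg : HasCompactSupport g) (hg1 : Integrable g volume)
    (n : ℤ) : fourierCoeff (fun x : UnitAddCircle => (periodize g x : ℂ)) n =
      ∫ x : ℝ, Complex.exp (-(2 * Real.pi * n * x : ℝ) * Complex.I) * (g x : ℂ) := by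
  obtain ⟨L, hL⟩ := exists_finset_periodize hg
  set G : ℝ → ℂ := fun x => Complex.exp (-(2 * Real.pi * n * x : ℝ) * Complex.I) * (g x : ℂ)
  have hG : Integrable G volume := by
    refine hg1.ofReal.bdd_mul (c := 1) ?_ (Filter.Eventually.of_forall fun x => ?_)
    · exact Continuous.aestronglyMeasurable (by fun_prop)
    · rw [← Complex.ofReal_neg, Complex.norm_exp_ofReal_mul_I]
  have hexp : ∀ (x : ℝ) (l : ℤ), Complex.exp (-(2 * Real.pi * n * (x + l) : ℝ) * Complex.I) =
      Complex.exp (-(2 * Real.pi * n * x : ℝ) * Complex.I) := by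
    intro x l
    rw [Complex.exp_eq_exp_iff_exists_int]
    exact ⟨-(n * l), by push_cast; ring⟩
  have hGint : ∀ l : ℤ, IntervalIntegrable (fun x : ℝ => G (x + l)) volume 0 1 := fun l =>
    (hG.comp_add_right (l : ℝ)).intervalIntegrable
  rw [fourierCoeff_eq_intervalIntegral _ n 0, zero_add, div_one, one_smul]
  -- Unfolding: the integral over the line is cut into integer translates of `[0, 1]`, of which only
  -- those in `L` contribute, so sum and integral are interchanged over a finite set.
  rw [← (hG.hasSum_intervalIntegral_comp_add_int).tsum_eq, tsum_eq_sum (s := L)]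
  · rw [← intervalIntegral.integral_finsetSum fun l _ => hGint l]
    refine intervalIntegral.integral_congr fun x hx => ?_
    rw [Set.uIcc_of_le zero_le_one] at hx
    simp only [smul_eq_mul]
    rw [periodize_coe, tsum_eq_sum (s := L) (fun l hl => hL x hx l hl), Complex.ofReal_sum,
      Finset.mul_sum]
    refine Finset.sum_congr rfl fun l _ => ?_
    simp only [G]
    rw [hexp, fourier_coe_apply]
    congr 2
    push_cast
    ring
  · intro l hl
    refine intervalIntegral.integral_zero_ae (Filter.Eventually.of_forall fun x hx => ?_)
    rw [Set.uIoc_of_le zero_le_one] at hx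
    simp [G, hL x ⟨hx.1.le, hx.2⟩ l hl]

/-! ### Fourier coefficients of the periodized wavelets -/

/-- The Fourier transform of `ψ`. -/
def fourierLine (ψ : ℝ → ℝ) (t : ℝ) : ℂ :=
  ∫ y : ℝ, Complex.exp (-(2 * Real.pi * t * y : ℝ) * Complex.I) * (ψ y : ℂ)

lemma HasSupport.hasCompactSupport {ψ : ℝ → ℝ} {S : ℝ} (h : HasSupport ψ S) :
    HasCompactSupport ψ := by
  rw [HasCompactSupport, h]
  exact isCompact_Icc

lemma HasSupport.eq_zero {ψ : ℝ → ℝ} {S : ℝ} (h : HasSupport ψ S) {x : ℝ}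
    (hx : x ∉ Set.Icc 0 S) : ψ x = 0 := by
  rw [← h] at hx
  exact image_eq_zero_of_notMem_tsupport hx

lemma integrable_of_hasCompactSupport {ψ : ℝ → ℝ} (h : HasCompactSupport ψ)
    (h2 : MemLp ψ 2 volume) : Integrable ψ volume := by
  have h3 : MemLp ψ 2 (volume.restrict (tsupport ψ)) := h2.restrict _
  have : IsFiniteMeasure (volume.restrict (tsupport ψ)) :=
    ⟨by simpa using h.isCompact.measure_lt_top⟩
  have h4 : IntegrableOn ψ (tsupport ψ) volume := h3.integrable (by norm_num)
  exact (integrableOn_iff_integrable_of_support_subset (subset_tsupport ψ)).1 h4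

lemma dilate_eq_comp (ψ : ℝ → ℝ) (j k : ℤ) : dilate ψ j k =
    fun x => (2 : ℝ) ^ ((j : ℝ) / 2) * (ψ ∘ fun x => (2 : ℝ) ^ j * x - (k : ℝ)) x := rfl

lemma hasCompactSupport_dilate {ψ : ℝ → ℝ} (h : HasCompactSupport ψ) (j k : ℤ) :
    HasCompactSupport (dilate ψ j k) := by
  rw [dilate_eq_comp]
  refine HasCompactSupport.mul_left ?_
  exact h.comp_homeomorph ((Homeomorph.mulLeft₀ ((2 : ℝ) ^ j) (by positivity)).trans
    (Homeomorph.subRight (k : ℝ)))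

lemma memLp_dilate {ψ : ℝ → ℝ} (h : MemLp ψ 2 volume) (j k : ℤ) :
    MemLp (dilate ψ j k) 2 volume := by
  rw [dilate_eq_comp]
  refine MemLp.const_mul ?_ _
  have h1 : MemLp (fun x => ψ (x - (k : ℝ))) 2 volume :=
    h.comp_measurePreserving (measurePreserving_sub_right volume (k : ℝ))
  have h1m := h1.1
  have h0 : ((2 : ℝ) ^ j) ≠ 0 := by positivity
  rw [memLp_two_iff_integrable_sq] at h1 ⊢
  · exact h1.comp_mul_left' h0
  · exact h1m.comp_quasiMeasurePreserving (f := fun x => (2 : ℝ) ^ j * x)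
      ⟨by fun_prop, by rw [Real.map_volume_mul_left h0]; exact Measure.smul_absolutelyContinuous⟩
  · exact h1m

lemma memLp_psiPer {ψ : ℝ → ℝ} (h : HasCompactSupport ψ) (h2 : MemLp ψ 2 volume) (j k : ℤ) :
    MemLp (fun x => (psiPer ψ j k x : ℂ)) 2 circleMeasure := by
  unfold psiPer
  split_ifs
  · exact memLp_periodize (hasCompactSupport_dilate h j k) (memLp_dilate h2 j k)
  · exact memLp_const _

/-- The Fourier coefficients of the periodized wavelets. -/
def waveletHat (ψ : ℝ → ℝ) (j k n : ℤ) : ℂ :=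
  fourierCoeff (fun x : UnitAddCircle => (psiPer ψ j k x : ℂ)) n

/-- Substitute `y = 2^j x - k`. The index `k` enters only through a character modulo `2^j`, which is
the source of the discrete orthogonality used below. -/
lemma waveletHat_of_nonneg {ψ : ℝ → ℝ} (h : HasCompactSupport ψ) (h2 : MemLp ψ 2 volume)
    {j : ℤ} (hj : 0 ≤ j) (k n : ℤ) : waveletHat ψ j k n =
      ((2 : ℝ) ^ (-(j : ℝ) / 2) : ℝ) *
        Complex.exp (-(2 * Real.pi * (n * k / 2 ^ j) : ℝ) * Complex.I) *
        fourierLine ψ (n / 2 ^ j) := by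
  have hN : (0 : ℝ) < (2 : ℝ) ^ j := by positivity
  unfold waveletHat psiPer
  rw [if_pos hj, fourierCoeff_periodize (hasCompactSupport_dilate h j k)
    (integrable_of_hasCompactSupport (hasCompactSupport_dilate h j k) (memLp_dilate h2 j k))]
  set F : ℝ → ℂ := fun y => Complex.exp (-(2 * Real.pi * (n * k / 2 ^ j) : ℝ) * Complex.I) *
    (((2 : ℝ) ^ ((j : ℝ) / 2) : ℝ) *
      (Complex.exp (-(2 * Real.pi * (n / 2 ^ j) * y : ℝ) * Complex.I) * (ψ y : ℂ)))
  have h1 : ∀ x : ℝ, Complex.exp (-(2 * Real.pi * n * x : ℝ) * Complex.I) * (dilate ψ j k x : ℂ) =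
      F ((2 : ℝ) ^ j * x - (k : ℝ)) := by
    intro x
    have : Complex.exp (-(2 * Real.pi * n * x : ℝ) * Complex.I) =
        Complex.exp (-(2 * Real.pi * (n * k / 2 ^ j) : ℝ) * Complex.I) *
        Complex.exp (-(2 * Real.pi * (n / 2 ^ j) * ((2 : ℝ) ^ j * x - (k : ℝ)) : ℝ)
          * Complex.I) := by
      rw [← Complex.exp_add, ← add_mul, ← neg_add, ← Complex.ofReal_add]
      congr 4
      field_simp
      ring
    simp only [F, dilate]
    rw [this]
    push_cast
    ring
  simp_rw [h1]
  rw [Measure.integral_comp_mul_left (fun x => F (x - (k : ℝ))) ((2 : ℝ) ^ j),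
    integral_sub_right_eq_self F (k : ℝ)]
  simp only [F]
  rw [integral_const_mul, integral_const_mul, abs_of_pos (inv_pos.2 hN), Complex.real_smul]
  have h3 : ((2 : ℝ) ^ j)⁻¹ * (2 : ℝ) ^ ((j : ℝ) / 2) = (2 : ℝ) ^ (-(j : ℝ) / 2) := by
    rw [← Real.rpow_intCast, ← Real.rpow_neg (by norm_num), ← Real.rpow_add (by norm_num)]
    congr 1
    ring
  rw [← h3]
  push_cast
  simp only [fourierLine]
  push_cast
  ring

lemma waveletHat_neg_one (ψ : ℝ → ℝ) (k n : ℤ) :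
    waveletHat ψ (-1) k n = if n = 0 then 1 else 0 := by
  have : (fun x : UnitAddCircle => (psiPer ψ (-1) k x : ℂ)) = fourier (T := 1) 0 := by
    funext x
    simp [psiPer]
  rw [waveletHat, this, fourierCoeff_fourier]
  simp [Pi.single_apply]

/-! ### Size of the Fourier transform of the wavelet near the origin -/

/-- Test the upper Riesz bound on a unit sequence. -/
lemma IsRieszOnLevels.eLpNorm_psiPer_le {ψ : ℝ → ℝ} {γ δ : ℝ≥0} (h : IsRieszOnLevels ψ γ δ)
    {j : ℤ} (hj : 0 ≤ j) :
    eLpNorm (fun x => (psiPer ψ j 0 x : ℂ)) 2 circleMeasure ^ 2 ≤ δ := by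
  have h0 : (0 : ℤ) ∈ idx j := by simp [idx, hj]
  have h1 := (h.2 j hj (Pi.single 0 1)).2
  have h2 : ∀ g : ℤ → ℂ, ∑ k ∈ idx j, (Pi.single 0 1 : ℤ → ℂ) k * g k = g 0 := by
    intro g
    rw [Finset.sum_eq_single_of_mem 0 h0 (fun k _ hk => by simp [hk])]
    simp
  have h3 : ∑ k ∈ idx j, ‖(Pi.single 0 1 : ℤ → ℂ) k‖ₑ ^ 2 = 1 := by
    rw [Finset.sum_eq_single_of_mem 0 h0 (fun k _ hk => by simp [hk])]
    simp
  rw [h3, mul_one] at h1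
  simpa only [h2 fun k => (psiPer ψ j k _ : ℂ)] using h1

/-- The `L₁`-norm of the wavelet is controlled by the upper Riesz constant and the support. -/
lemma integral_abs_le {ψ : ℝ → ℝ} {S : ℝ} {γ δ : ℝ≥0} (h2 : MemLp ψ 2 volume)
    (hS : HasSupport ψ S) (hR : IsRieszOnLevels ψ γ δ) :
    ∫ y, |ψ y| ≤ (2 : ℝ) ^ ((⌈S⌉₊ : ℝ) / 2) * Real.sqrt δ := by
  -- On this level `S ≤ 2^J`, so `dilate ψ J 0` vanishes off `[0, 1]` and its periodization has no
  -- overlaps: the `L₁`-norms on the line and on the circle agree, and scaling back costs `2^(J/2)`.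
  set J : ℤ := ((⌈S⌉₊ : ℕ) : ℤ) with hJ
  have hJ0 : 0 ≤ J := by positivity
  have hJr : ((J : ℝ)) = (⌈S⌉₊ : ℝ) := by simp [hJ]
  have hN : (0 : ℝ) < (2 : ℝ) ^ J := by positivity
  have hSN : S ≤ (2 : ℝ) ^ J := by
    refine (Nat.le_ceil S).trans ?_
    rw [hJ, zpow_natCast]
    exact_mod_cast (Nat.lt_two_pow_self (n := ⌈S⌉₊)).le
  have hzero : ∀ x : ℝ, x ∉ Set.Icc (0 : ℝ) 1 → dilate ψ J 0 x = 0 := by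
    intro x hx
    have : (2 : ℝ) ^ J * x - ((0 : ℤ) : ℝ) ∉ Set.Icc 0 S := by
      intro hmem
      rw [Int.cast_zero, sub_zero] at hmem
      refine hx ⟨nonneg_of_mul_nonneg_right hmem.1 hN, ?_⟩
      have := hmem.2.trans hSN
      exact le_of_mul_le_mul_left (by linarith) hN
    simp only [dilate, hS.eq_zero this, mul_zero]
  have hmem := memLp_psiPer hS.hasCompactSupport h2 J 0
  have hcirc : ∫ x, ‖(psiPer ψ J 0 x : ℂ)‖ ∂circleMeasure ≤ Real.sqrt δ := by
    rw [integral_norm_eq_lintegral_enorm hmem.1, ← eLpNorm_one_eq_lintegral_enorm]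
    refine ENNReal.toReal_le_of_le_ofReal (Real.sqrt_nonneg _) ?_
    -- The circle has mass one, so the `L₁`-norm is at most the `L₂`-norm.
    refine (eLpNorm_le_eLpNorm_of_exponent_le (p := 1) (q := 2) (by norm_num) hmem.1).trans ?_
    have h3 := hR.eLpNorm_psiPer_le hJ0
    have h4 : (δ : ℝ≥0∞) = ENNReal.ofReal (Real.sqrt δ) ^ 2 := by
      rw [← ENNReal.ofReal_pow (Real.sqrt_nonneg _), Real.sq_sqrt δ.coe_nonneg, ENNReal.ofReal_coe_nnreal]
    rw [h4] at h3
    exact (ENNReal.pow_le_pow_left_iff two_ne_zero).1 h3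
  have hline : ∫ x, |dilate ψ J 0 x| = ∫ x, ‖(psiPer ψ J 0 x : ℂ)‖ ∂circleMeasure := by
    rw [← volume_eq_circleMeasure, ← AddCircle.integral_preimage 1 0, zero_add,
      integral_Ioc_eq_integral_Ioo,
      ← setIntegral_eq_integral_of_forall_compl_eq_zero (s := Set.Icc (0 : ℝ) 1)
        (fun x hx => by rw [hzero x hx, abs_zero]), integral_Icc_eq_integral_Ioo]
    refine setIntegral_congr_fun measurableSet_Ioo fun x hx => ?_
    simp only [psiPer, if_pos hJ0]
    rw [periodize_coe, tsum_eq_single 0, Complex.norm_real, Real.norm_eq_abs, Int.cast_zero,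
      add_zero]
    intro l hl
    refine hzero _ fun hmem => hl ?_
    have h5 : ((-1 : ℤ) : ℝ) < l := by push_cast; linarith [hmem.1, hx.2]
    have h6 : (l : ℝ) < ((1 : ℤ) : ℝ) := by push_cast; linarith [hmem.2, hx.1]
    have h5' : -1 < l := by exact_mod_cast h5
    have h6' : l < 1 := by exact_mod_cast h6
    omega
  have hscale : ∫ x, |dilate ψ J 0 x| = (2 : ℝ) ^ (-(J : ℝ) / 2) * ∫ y, |ψ y| := by
    have : ∀ x, |dilate ψ J 0 x| = (2 : ℝ) ^ ((J : ℝ) / 2) * |ψ ((2 : ℝ) ^ J * x)| := by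
      intro x
      rw [dilate, abs_mul, abs_of_pos (by positivity), Int.cast_zero, sub_zero]
    simp_rw [this]
    rw [integral_const_mul, Measure.integral_comp_mul_left (fun x => |ψ x|),
      abs_of_pos (inv_pos.2 hN), smul_eq_mul, ← mul_assoc, ← Real.rpow_intCast,
      ← Real.rpow_neg (by norm_num), ← Real.rpow_add (by norm_num)]
    congr 2
    ring
  have hfin : (2 : ℝ) ^ (-(J : ℝ) / 2) * ∫ y, |ψ y| ≤ Real.sqrt δ := by
    rw [← hscale, hline]
    exact hcirc
  calc ∫ y, |ψ y| = (2 : ℝ) ^ ((J : ℝ) / 2) * ((2 : ℝ) ^ (-(J : ℝ) / 2) * ∫ y, |ψ y|) := by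
        rw [← mul_assoc, ← Real.rpow_add (by norm_num)]
        simp [neg_div]
    _ ≤ (2 : ℝ) ^ ((J : ℝ) / 2) * Real.sqrt δ :=
        mul_le_mul_of_nonneg_left hfin (by positivity)
    _ = _ := by rw [hJr]

/-- The constant in the bound `|ψ^(t)| ≤ K |t|^m` for `|t| ≤ 1`. -/
def decayConst (m : ℕ) (S : ℝ) (δ : ℝ≥0) : ℝ :=
  (2 * Real.pi * |S|) ^ m * Real.exp (2 * Real.pi * |S|) *
    ((2 : ℝ) ^ ((⌈S⌉₊ : ℝ) / 2) * Real.sqrt δ)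

/-- Vanishing moments make the Fourier transform vanish of order `m` at the origin. -/
lemma norm_fourierLine_le {ψ : ℝ → ℝ} {S : ℝ} {γ δ : ℝ≥0} {m : ℕ} (h2 : MemLp ψ 2 volume)
    (hS : HasSupport ψ S) (hm : HasVanishingMoments ψ m) (hR : IsRieszOnLevels ψ γ δ)
    {t : ℝ} (ht : |t| ≤ 1) : ‖fourierLine ψ t‖ ≤ decayConst m S δ * |t| ^ m := by
  have hint : Integrable ψ volume := integrable_of_hasCompactSupport hS.hasCompactSupport h2
  have hint' : Integrable (fun y => (ψ y : ℂ)) volume := hint.ofReal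
  set z : ℝ → ℂ := fun y => -(2 * Real.pi * t * y : ℝ) * Complex.I with hz
  have hbd : ∀ y ∈ Set.Icc 0 S, ‖z y‖ ≤ 2 * Real.pi * |S| * |t| := by
    intro y hy
    simp only [hz]
    rw [norm_mul, Complex.norm_I, mul_one, norm_neg, Complex.norm_real, Real.norm_eq_abs, abs_mul,
      abs_mul, abs_of_pos (by positivity : 0 < 2 * Real.pi)]
    have hyS : |y| ≤ |S| := abs_le_abs_of_nonneg hy.1 hy.2
    calc 2 * Real.pi * |t| * |y| ≤ 2 * Real.pi * |t| * |S| := by gcongr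
      _ = _ := by ring
  have hpow : ∀ β : ℕ, Integrable (fun y => z y ^ β / (β.factorial : ℂ) * (ψ y : ℂ)) volume := by
    intro β
    refine (hint.norm.const_mul ((2 * Real.pi * |S| * |t|) ^ β / (β.factorial : ℝ))).mono' ?_ ?_
    · exact (Continuous.aestronglyMeasurable (by fun_prop)).mul hint'.1
    · refine Filter.Eventually.of_forall fun y => ?_
      by_cases hy : y ∈ Set.Icc 0 S
      · rw [norm_mul, norm_div, norm_pow, Complex.norm_natCast, Complex.norm_real]
        gcongr
        exact hbd y hy
      · simp [hS.eq_zero hy]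
  -- The Taylor polynomial of the exponential has degree below `m`, so the moments kill it; only the
  -- Taylor remainder is left to be integrated against `ψ`.
  have hmom : ∫ y, (∑ β ∈ Finset.range m, z y ^ β / (β.factorial : ℂ)) * (ψ y : ℂ) = 0 := by
    simp_rw [Finset.sum_mul]
    rw [integral_finsetSum _ fun β _ => hpow β]
    refine Finset.sum_eq_zero fun β hβ => ?_
    have : ∀ y, z y ^ β / (β.factorial : ℂ) * (ψ y : ℂ) =
        ((-(2 * Real.pi * t : ℝ) * Complex.I) ^ β / (β.factorial : ℂ)) *
          ((ψ y * y ^ β : ℝ) : ℂ) := by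
      intro y
      simp only [hz]
      push_cast
      ring
    simp_rw [this]
    rw [integral_const_mul, integral_complex_ofReal, hm β (Finset.mem_range.1 hβ)]
    simp
  have hexp : Integrable (fun y => Complex.exp (z y) * (ψ y : ℂ)) volume := by
    refine hint'.bdd_mul (c := 1) (Continuous.aestronglyMeasurable (by fun_prop))
      (Filter.Eventually.of_forall fun x => ?_)
    simp only [hz]
    rw [← Complex.ofReal_neg, Complex.norm_exp_ofReal_mul_I]
  have heq : fourierLine ψ t =
      ∫ y, (Complex.exp (z y) - ∑ β ∈ Finset.range m, z y ^ β / (β.factorial : ℂ)) *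
        (ψ y : ℂ) := by
    simp_rw [sub_mul]
    rw [integral_sub hexp, hmom, sub_zero]
    · rfl
    · simp_rw [Finset.sum_mul]
      exact integrable_finsetSum _ fun β _ => hpow β
  -- Bound for the Taylor remainder on the support; `|t| ≤ 1` removes `t` from the exponential
  -- factor, so the power `|t|^m` alone carries the decay.
  set A := (2 * Real.pi * |S| * |t|) ^ m * Real.exp (2 * Real.pi * |S|) with hA
  rw [heq]
  calc _ ≤ ∫ y, A * |ψ y| := by
        refine norm_integral_le_of_norm_le (hint.norm.const_mul A)
          (Filter.Eventually.of_forall fun y => ?_)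
        by_cases hy : y ∈ Set.Icc 0 S
        · rw [norm_mul, Complex.norm_real]
          refine mul_le_mul_of_nonneg_right ?_ (norm_nonneg _)
          refine (Complex.norm_exp_sub_sum_le_norm_mul_exp (z y) m).trans ?_
          have h1 := hbd y hy
          have h3 : 2 * Real.pi * |S| * |t| ≤ 2 * Real.pi * |S| :=
            mul_le_of_le_one_right (by positivity) ht
          rw [hA]
          gcongr
          exact h1.trans h3
        · simp [hS.eq_zero hy]
    _ = A * ∫ y, |ψ y| := integral_const_mul _ _
    _ ≤ A * ((2 : ℝ) ^ ((⌈S⌉₊ : ℝ) / 2) * Real.sqrt δ) :=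
        mul_le_mul_of_nonneg_left (integral_abs_le h2 hS hR) (by positivity)
    _ = _ := by rw [hA, decayConst, mul_pow _ |t|]; ring

/-! ### Discrete orthogonality -/

lemma sum_Ico_int_eq_sum_range {M : Type*} [AddCommMonoid M] (N : ℕ) (g : ℤ → M) :
    ∑ k ∈ Finset.Ico (0 : ℤ) N, g k = ∑ k ∈ Finset.range N, g k := by
  refine Finset.sum_nbij' Int.toNat (fun k : ℕ => (k : ℤ)) ?_ ?_ ?_ ?_ ?_
  · intro k hk
    rw [Finset.mem_Ico] at hk
    rw [Finset.mem_range]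
    omega
  · intro k hk
    rw [Finset.mem_range] at hk
    rw [Finset.mem_Ico]
    omega
  · intro k hk
    rw [Finset.mem_Ico] at hk
    omega
  · intro k _
    rfl
  · intro k hk
    rw [Finset.mem_Ico] at hk
    rw [Int.toNat_of_nonneg hk.1]

lemma sum_exp_range (N : ℕ) (hN : 0 < N) (l : ℤ) :
    ∑ k ∈ Finset.range N, Complex.exp ((2 * Real.pi * (l * k / N) : ℝ) * Complex.I) =
      if (N : ℤ) ∣ l then (N : ℂ) else 0 := by
  have hN' : (N : ℂ) ≠ 0 := by exact_mod_cast hN.ne'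
  set z : ℂ := Complex.exp (2 * Real.pi * Complex.I * (l / N)) with hz
  have h1 : ∀ k : ℕ, Complex.exp ((2 * Real.pi * (l * k / N) : ℝ) * Complex.I) = z ^ k := by
    intro k
    rw [hz, ← Complex.exp_nat_mul]
    congr 1
    push_cast
    ring
  have h2 : z = 1 ↔ (N : ℤ) ∣ l := by
    rw [hz, Complex.exp_eq_one_iff]
    have hpi : (2 * Real.pi * Complex.I : ℂ) ≠ 0 := Complex.two_pi_I_ne_zero
    constructor
    · rintro ⟨n, hn⟩
      refine ⟨n, ?_⟩
      rw [mul_comm (n : ℂ)] at hn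
      have := mul_left_cancel₀ hpi hn
      rw [div_eq_iff hN'] at this
      have h3 : (l : ℂ) = ((N * n : ℤ) : ℂ) := by rw [this]; push_cast; ring
      exact_mod_cast h3
    · rintro ⟨n, rfl⟩
      refine ⟨n, ?_⟩
      push_cast
      field_simp
  have h4 : z ^ N = 1 := by
    rw [hz, ← Complex.exp_nat_mul, Complex.exp_eq_one_iff]
    exact ⟨l, by field_simp⟩
  simp_rw [h1]
  split_ifs with h
  · simp [h2.2 h]
  · rw [geom_sum_eq (fun h' => h (h2.1 h')), h4]
    simp

/-- Parseval's identity for trigonometric polynomials, with pairwise incongruent frequencies,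
sampled on a grid. -/
lemma sum_sq_norm_sampled (N : ℕ) (hN : 0 < N) (T : Finset ℤ)
    (hT : ∀ ξ ∈ T, ∀ η ∈ T, (N : ℤ) ∣ ξ - η → ξ = η) (a : ℤ → ℂ) :
    ∑ k ∈ Finset.Ico (0 : ℤ) N,
        ‖∑ ξ ∈ T, a ξ * Complex.exp ((2 * Real.pi * (ξ * k / N) : ℝ) * Complex.I)‖ ^ 2 =
      N * ∑ ξ ∈ T, ‖a ξ‖ ^ 2 := by
  -- Once the square is expanded, summing over `k` leaves only pairs congruent modulo `N`, and `hT`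
  -- reduces those to the diagonal.
  have key : ∀ k : ℕ, ((‖∑ ξ ∈ T, a ξ *
      Complex.exp ((2 * Real.pi * (ξ * ((k : ℤ) : ℝ) / N) : ℝ) * Complex.I)‖ ^ 2 : ℝ) : ℂ) =
      ∑ ξ ∈ T, ∑ η ∈ T, a ξ * (starRingEnd ℂ) (a η) *
        Complex.exp ((2 * Real.pi * (((ξ - η : ℤ) : ℝ) * k / N) : ℝ) * Complex.I) := by
    intro k
    rw [Complex.ofReal_pow, ← Complex.mul_conj', map_sum, Finset.sum_mul_sum]
    refine Finset.sum_congr rfl fun ξ _ => Finset.sum_congr rfl fun η _ => ?_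
    rw [map_mul, ← Complex.exp_conj, map_mul, Complex.conj_I, Complex.conj_ofReal,
      mul_mul_mul_comm, ← Complex.exp_add]
    congr 2
    push_cast
    ring
  have : ((∑ k ∈ Finset.Ico (0 : ℤ) N,
        ‖∑ ξ ∈ T, a ξ * Complex.exp ((2 * Real.pi * (ξ * k / N) : ℝ) * Complex.I)‖ ^ 2 : ℝ) : ℂ) =
      ((N * ∑ ξ ∈ T, ‖a ξ‖ ^ 2 : ℝ) : ℂ) := by
    rw [sum_Ico_int_eq_sum_range, Complex.ofReal_sum, Finset.sum_congr rfl fun k _ => key k,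
      Finset.sum_comm]
    simp_rw [Finset.sum_comm (s := Finset.range N), ← Finset.mul_sum]
    simp_rw [sum_exp_range N hN]
    rw [Complex.ofReal_mul, Complex.ofReal_sum, Finset.mul_sum]
    refine Finset.sum_congr rfl fun ξ hξ => ?_
    rw [Finset.sum_eq_single_of_mem ξ hξ]
    · simp [Complex.mul_conj', mul_comm]
    · intro η hη hne
      rw [if_neg fun h => hne (hT ξ hξ η hη h).symm, mul_zero]
  exact_mod_cast this

/-! ### The analysis operator on trigonometric polynomials -/

lemma sum_sq_fourierCoeff_le {G : UnitAddCircle → ℂ} (hG : MemLp G 2 circleMeasure)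
    (T : Finset ℤ) :
    ∑ ξ ∈ T, ‖fourierCoeff G ξ‖ ^ 2 ≤ (eLpNorm G 2 circleMeasure).toReal ^ 2 := by
  have h := (orthonormal_fourier (T := 1)).sum_inner_products_le (hG.toLp G) (s := T)
  rw [Lp.norm_toLp] at h
  refine le_trans (le_of_eq (Finset.sum_congr rfl fun ξ _ => ?_)) h
  rw [← congrFun coe_fourierBasis ξ, ← HilbertBasis.repr_apply_apply, fourierBasis_repr,
    fourierCoeff_congr_ae hG.coeFn_toLp]

/-- The upper Riesz bound, by duality, bounds the analysis operator. -/
lemma sum_sq_analysis_le {ψ : ℝ → ℝ} {γ δ : ℝ≥0} (hc : HasCompactSupport ψ)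
    (h2 : MemLp ψ 2 volume) (hR : IsRieszOnLevels ψ γ δ) {j : ℤ} (hj : 0 ≤ j) (T : Finset ℤ)
    (c : ℤ → ℂ) :
    ∑ k ∈ idx j, ‖∑ ξ ∈ T, c ξ * (starRingEnd ℂ) (waveletHat ψ j k ξ)‖ ^ 2 ≤
      δ * ∑ ξ ∈ T, ‖c ξ‖ ^ 2 := by
  -- The analysis vector `b` is fed back as synthesis coefficients of `G`. Then `∑ |b k|²` equals
  -- the pairing of `c` with the Fourier coefficients of `G`, and Cauchy–Schwarz, Bessel and the
  -- Riesz bound give `X² ≤ Y · δX`.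
  set b : ℤ → ℂ := fun k => ∑ ξ ∈ T, c ξ * (starRingEnd ℂ) (waveletHat ψ j k ξ) with hb
  set G : UnitAddCircle → ℂ := fun x => ∑ k ∈ idx j, b k * (psiPer ψ j k x : ℂ) with hG
  have hmem : ∀ k ∈ idx j, MemLp (fun x => b k * (psiPer ψ j k x : ℂ)) 2 circleMeasure :=
    fun k _ => (memLp_psiPer hc h2 j k).const_mul _
  have hGmem : MemLp G 2 circleMeasure := memLp_finsetSum _ hmem
  have hGhat : ∀ ξ, fourierCoeff G ξ = ∑ k ∈ idx j, b k * waveletHat ψ j k ξ := by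
    intro ξ
    have hG' : G = ∑ k ∈ idx j, fun x => b k * (psiPer ψ j k x : ℂ) := by
      funext x
      simp [hG]
    rw [hG', fourierCoeff.sum _ _ fun k hk => (hmem k hk).integrable (by norm_num)]
    simp only [Finset.sum_apply, waveletHat, ← fourierCoeff.const_mul]
  set X := ∑ k ∈ idx j, ‖b k‖ ^ 2 with hX
  set Y := ∑ ξ ∈ T, ‖c ξ‖ ^ 2 with hY
  have hX0 : 0 ≤ X := Finset.sum_nonneg fun _ _ => by positivity
  have hY0 : 0 ≤ Y := Finset.sum_nonneg fun _ _ => by positivity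
  have hGX : ∑ ξ ∈ T, ‖fourierCoeff G ξ‖ ^ 2 ≤ δ * X := by
    refine (sum_sq_fourierCoeff_le hGmem T).trans ?_
    have h := (hR.2 j hj b).2
    have h3 : ∑ k ∈ idx j, ‖b k‖ₑ ^ 2 = ENNReal.ofReal X := by
      rw [hX, ENNReal.ofReal_sum_of_nonneg fun _ _ => by positivity]
      refine Finset.sum_congr rfl fun k _ => ?_
      rw [ENNReal.ofReal_pow (norm_nonneg _), ofReal_norm]
    rw [h3, ← ENNReal.ofReal_coe_nnreal, ← ENNReal.ofReal_mul δ.coe_nonneg] at h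
    rw [← ENNReal.toReal_pow]
    exact ENNReal.toReal_le_of_le_ofReal (by positivity) h
  have hdual : ((X : ℝ) : ℂ) = ∑ ξ ∈ T, c ξ * (starRingEnd ℂ) (fourierCoeff G ξ) := by
    simp_rw [hGhat, map_sum, map_mul, Finset.mul_sum]
    rw [Finset.sum_comm, hX, Complex.ofReal_sum]
    refine Finset.sum_congr rfl fun k _ => ?_
    rw [Complex.ofReal_pow, ← Complex.mul_conj']
    nth_rewrite 1 [hb]
    rw [Finset.sum_mul]
    refine Finset.sum_congr rfl fun ξ _ => ?_
    ring
  have hcs : X ^ 2 ≤ Y * (δ * X) := by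
    have h1 : X ≤ ∑ ξ ∈ T, ‖c ξ‖ * ‖fourierCoeff G ξ‖ := by
      have : X = ‖((X : ℝ) : ℂ)‖ := by rw [Complex.norm_real, Real.norm_of_nonneg hX0]
      rw [this, hdual]
      refine (norm_sum_le _ _).trans (le_of_eq (Finset.sum_congr rfl fun ξ _ => ?_))
      rw [norm_mul, RCLike.norm_conj]
    calc X ^ 2 ≤ (∑ ξ ∈ T, ‖c ξ‖ * ‖fourierCoeff G ξ‖) ^ 2 := by gcongr
      _ ≤ Y * ∑ ξ ∈ T, ‖fourierCoeff G ξ‖ ^ 2 := Finset.sum_mul_sq_le_sq_mul_sq _ _ _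
      _ ≤ Y * (δ * X) := by gcongr
  rcases hX0.eq_or_lt with h0 | hpos
  · rw [← h0]; positivity
  · refine le_of_mul_le_mul_right ?_ hpos
    calc X * X = X ^ 2 := by ring
      _ ≤ Y * (δ * X) := hcs
      _ = δ * Y * X := by ring

/-- The index of the dyadic block that contains the frequency `ξ`. -/
def freqBlock (ξ : ℤ) : ℤ := if ξ = 0 then -1 else (Nat.log 2 ξ.natAbs : ℤ)

/-- The squared norm of the analysis operator on level `j` is, up to a constant, at most
`blockWeight m j n` on the frequencies of the dyadic block `n`. -/
def blockWeight (m : ℕ) (j n : ℤ) : ℝ :=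
  if j = -1 ∧ n = -1 then 1
  else if 0 ≤ j ∧ 0 ≤ n then min 1 ((2 : ℝ) ^ (2 * (m : ℤ) * (n + 1 - j))) else 0

lemma blockWeight_nonneg (m : ℕ) (j n : ℤ) : 0 ≤ blockWeight m j n := by
  unfold blockWeight
  split_ifs <;> positivity

lemma freqBlock_eq_neg_one_iff {ξ : ℤ} : freqBlock ξ = -1 ↔ ξ = 0 := by
  unfold freqBlock
  split_ifs with h
  · simp [h]
  · simp [h]

lemma freqBlock_nonneg {ξ : ℤ} (h : ξ ≠ 0) : 0 ≤ freqBlock ξ := by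
  rw [freqBlock, if_neg h]
  positivity

lemma two_zpow_freqBlock_le {ξ : ℤ} (h : ξ ≠ 0) : (2 : ℝ) ^ freqBlock ξ ≤ |(ξ : ℝ)| := by
  rw [freqBlock, if_neg h, zpow_natCast, ← Int.cast_abs, Int.abs_eq_natAbs, Int.cast_natCast]
  exact_mod_cast Nat.pow_log_le_self 2 (Int.natAbs_ne_zero.2 h)

lemma lt_two_zpow_freqBlock (ξ : ℤ) : |(ξ : ℝ)| < (2 : ℝ) ^ (freqBlock ξ + 1) := by
  rcases eq_or_ne ξ 0 with rfl | h
  · simp [freqBlock]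
  · rw [freqBlock, if_neg h, ← Nat.cast_succ, zpow_natCast, ← Int.cast_abs, Int.abs_eq_natAbs,
      Int.cast_natCast]
    exact_mod_cast Nat.lt_pow_succ_log_self (by norm_num) _

/-- High frequencies lie in blocks `n ≥ j`, or in the one just below at worst, where the minimum is
saturated: the weight is free there. -/
lemma blockWeight_freqBlock_of_le {m : ℕ} {j ξ : ℤ} (hj : 0 ≤ j) (h : (2 : ℝ) ^ j ≤ |(ξ : ℝ)|) :
    blockWeight m j (freqBlock ξ) = 1 := by
  have h1 := h.trans_lt (lt_two_zpow_freqBlock ξ)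
  rw [zpow_lt_zpow_iff_right₀ (by norm_num)] at h1
  rw [blockWeight, if_neg (by omega), if_pos (by omega)]
  refine min_eq_left (one_le_zpow₀ (by norm_num) ?_)
  exact mul_nonneg (by positivity) (by omega)

/-- The `+ 1` in the exponent of `blockWeight` comes from the upper end `2^(n+1)` of block `n`. -/
lemma div_pow_le_blockWeight {m : ℕ} {j ξ : ℤ} (hj : 0 ≤ j) (hξ : ξ ≠ 0)
    (h : |(ξ : ℝ)| < (2 : ℝ) ^ j) :
    (|(ξ : ℝ)| / 2 ^ j) ^ (2 * m) ≤ blockWeight m j (freqBlock ξ) := by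
  have hb := freqBlock_nonneg hξ
  rw [blockWeight, if_neg (by omega), if_pos ⟨hj, hb⟩]
  have hN : (0 : ℝ) < (2 : ℝ) ^ j := by positivity
  refine le_min (pow_le_one₀ (by positivity) ((div_le_one hN).2 h.le)) ?_
  have h1 : |(ξ : ℝ)| / 2 ^ j ≤ (2 : ℝ) ^ (freqBlock ξ + 1 - j) := by
    rw [zpow_sub₀ (by norm_num)]
    gcongr
    exact (lt_two_zpow_freqBlock ξ).le
  calc _ ≤ ((2 : ℝ) ^ (freqBlock ξ + 1 - j)) ^ (2 * m) := by gcongr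
    _ = _ := by
      rw [← zpow_natCast, ← zpow_mul]
      congr 1
      push_cast
      ring

lemma sq_norm_add_le (a b : ℂ) : ‖a + b‖ ^ 2 ≤ 2 * ‖a‖ ^ 2 + 2 * ‖b‖ ^ 2 := by
  have := norm_add_le a b
  nlinarith [sq_nonneg (‖a‖ - ‖b‖), norm_nonneg (a + b), norm_nonneg a, norm_nonneg b]

/-- The constant in the weighted bound for the univariate analysis operators. -/
def analysisConst (m : ℕ) (S : ℝ) (δ : ℝ≥0) : ℝ := 1 + 2 * δ + 4 * decayConst m S δ ^ 2

/-- Exact value of the analysis operator on pairwise incongruent frequencies. -/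
lemma sum_sq_analysis_eq_of_incongruent {ψ : ℝ → ℝ} (hc : HasCompactSupport ψ) (h2 : MemLp ψ 2 volume)
    {j : ℤ} (hj : 0 ≤ j) (T : Finset ℤ)
    (hT : ∀ ξ ∈ T, ∀ η ∈ T, (2 : ℤ) ^ j.toNat ∣ ξ - η → ξ = η) (c : ℤ → ℂ) :
    ∑ k ∈ idx j, ‖∑ ξ ∈ T, c ξ * (starRingEnd ℂ) (waveletHat ψ j k ξ)‖ ^ 2 =
      ∑ ξ ∈ T, ‖c ξ‖ ^ 2 * ‖fourierLine ψ (ξ / 2 ^ j)‖ ^ 2 := by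
  set N : ℕ := 2 ^ j.toNat with hNdef
  have hN0 : 0 < N := by positivity
  have hNj : (2 : ℝ) ^ j = (N : ℝ) := by
    conv_lhs => rw [← Int.toNat_of_nonneg hj]
    rw [zpow_natCast, hNdef]
    push_cast
    rfl
  have hidx : idx j = Finset.Ico (0 : ℤ) N := by
    rw [idx, if_pos hj, hNdef]
    push_cast
    rfl
  have hr : ((2 : ℝ) ^ (-(j : ℝ) / 2)) ^ 2 = (N : ℝ)⁻¹ := by
    rw [← Real.rpow_natCast, ← Real.rpow_mul (by norm_num), ← hNj, ← zpow_neg,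
      ← Real.rpow_intCast]
    congr 1
    push_cast
    ring
  have hterm : ∀ k : ℤ, ‖∑ ξ ∈ T, c ξ * (starRingEnd ℂ) (waveletHat ψ j k ξ)‖ ^ 2 =
      (N : ℝ)⁻¹ * ‖∑ ξ ∈ T, (c ξ * (starRingEnd ℂ) (fourierLine ψ (ξ / 2 ^ j))) *
        Complex.exp ((2 * Real.pi * (ξ * k / N) : ℝ) * Complex.I)‖ ^ 2 := by
    intro k
    have : ∑ ξ ∈ T, c ξ * (starRingEnd ℂ) (waveletHat ψ j k ξ) =
        ((2 : ℝ) ^ (-(j : ℝ) / 2) : ℝ) *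
        ∑ ξ ∈ T, (c ξ * (starRingEnd ℂ) (fourierLine ψ (ξ / 2 ^ j))) *
        Complex.exp ((2 * Real.pi * (ξ * k / N) : ℝ) * Complex.I) := by
      rw [Finset.mul_sum]
      refine Finset.sum_congr rfl fun ξ _ => ?_
      rw [waveletHat_of_nonneg hc h2 hj, map_mul, map_mul, Complex.conj_ofReal, ← Complex.exp_conj,
        map_mul, Complex.conj_I, map_neg, Complex.conj_ofReal, hNj, neg_mul_neg]
      ring
    rw [this, norm_mul, mul_pow, Complex.norm_real, Real.norm_of_nonneg (by positivity), hr]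
  simp_rw [hterm]
  rw [← Finset.mul_sum, hidx, sum_sq_norm_sampled N hN0 T (by exact_mod_cast hT), ← mul_assoc,
    inv_mul_cancel₀ (by positivity), one_mul]
  refine Finset.sum_congr rfl fun ξ _ => ?_
  rw [norm_mul, RCLike.norm_conj, mul_pow]

/-- The weighted bound for the univariate analysis operators on trigonometric polynomials. -/
lemma sum_sq_analysis_le_weight {ψ : ℝ → ℝ} {S : ℝ} {γ δ : ℝ≥0} {m : ℕ} (hm0 : 0 < m)
    (h2 : MemLp ψ 2 volume) (hS : HasSupport ψ S) (hm : HasVanishingMoments ψ m)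
    (hR : IsRieszOnLevels ψ γ δ) {j : ℤ} (hj : -1 ≤ j) (T : Finset ℤ) (c : ℤ → ℂ) :
    ∑ k ∈ idx j, ‖∑ ξ ∈ T, c ξ * (starRingEnd ℂ) (waveletHat ψ j k ξ)‖ ^ 2 ≤
      analysisConst m S δ * ∑ ξ ∈ T, ‖c ξ‖ ^ 2 * blockWeight m j (freqBlock ξ) := by
  have hC1 : 1 ≤ analysisConst m S δ := by
    have := δ.coe_nonneg
    unfold analysisConst
    nlinarith [sq_nonneg (decayConst m S δ)]
  have hnn : ∀ ξ, 0 ≤ ‖c ξ‖ ^ 2 * blockWeight m j (freqBlock ξ) := fun ξ =>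
    mul_nonneg (by positivity) (blockWeight_nonneg _ _ _)
  rcases eq_or_lt_of_le hj with rfl | hj'
  -- The constant function sees only the frequency zero, which is block `-1`, of weight one.
  · have hidx : idx (-1) = {0} := rfl
    rw [hidx, Finset.sum_singleton]
    refine le_trans ?_ (le_mul_of_one_le_left (Finset.sum_nonneg fun ξ _ => hnn ξ) hC1)
    simp only [waveletHat_neg_one, apply_ite (starRingEnd ℂ), map_one, map_zero, mul_ite, mul_one,
      mul_zero, Finset.sum_ite_eq']
    split_ifs with h0
    · refine le_trans (le_of_eq ?_) (Finset.single_le_sum (fun ξ _ => hnn ξ) h0)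
      simp [blockWeight, freqBlock]
    · simpa using Finset.sum_nonneg fun ξ (_ : ξ ∈ T) => hnn ξ
  have hj0 : 0 ≤ j := by omega
  have hc := hS.hasCompactSupport
  set K := decayConst m S δ with hK
  have hN : (0 : ℝ) < (2 : ℝ) ^ j := by positivity
  have hNZ : (2 : ℝ) ^ j = (((2 : ℤ) ^ j.toNat : ℤ) : ℝ) := by
    conv_lhs => rw [← Int.toNat_of_nonneg hj0]
    rw [zpow_natCast]
    push_cast
    rfl
  classical
  set H := T.filter fun ξ : ℤ => (2 : ℝ) ^ j ≤ |(ξ : ℝ)| with hH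
  set L := T.filter fun ξ : ℤ => ¬ (2 : ℝ) ^ j ≤ |(ξ : ℝ)| with hL
  have hhigh : ∑ k ∈ idx j, ‖∑ ξ ∈ H, c ξ * (starRingEnd ℂ) (waveletHat ψ j k ξ)‖ ^ 2 ≤
      δ * ∑ ξ ∈ H, ‖c ξ‖ ^ 2 * blockWeight m j (freqBlock ξ) := by
    refine (sum_sq_analysis_le hc h2 hR hj0 H c).trans (le_of_eq ?_)
    congr 1
    refine Finset.sum_congr rfl fun ξ hξ => ?_
    rw [blockWeight_freqBlock_of_le hj0 (Finset.mem_filter.1 hξ).2, mul_one]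
  have hpt : ∀ ξ ∈ L, ‖c ξ‖ ^ 2 * ‖fourierLine ψ (ξ / 2 ^ j)‖ ^ 2 ≤
      K ^ 2 * (‖c ξ‖ ^ 2 * blockWeight m j (freqBlock ξ)) := by
    intro ξ hξ
    have hlt := not_le.1 (Finset.mem_filter.1 hξ).2
    have habs : |(ξ : ℝ) / 2 ^ j| = |(ξ : ℝ)| / 2 ^ j := by rw [abs_div, abs_of_pos hN]
    have h1 := norm_fourierLine_le h2 hS hm hR (t := ξ / 2 ^ j)
      (by rw [habs]; exact ((div_lt_one hN).2 hlt).le)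
    have h3 : ‖fourierLine ψ (ξ / 2 ^ j)‖ ^ 2 ≤ K ^ 2 * blockWeight m j (freqBlock ξ) := by
      -- At frequency zero the weight vanishes for `j ≥ 0`, so `ψ^(0) = 0` is needed; this is where
      -- `0 < m` enters.
      rcases eq_or_ne ξ 0 with rfl | hne
      · simp only [Int.cast_zero, zero_div, abs_zero, zero_pow hm0.ne', mul_zero] at h1 ⊢
        rw [le_antisymm h1 (norm_nonneg _), zero_pow two_ne_zero]
        exact mul_nonneg (sq_nonneg _) (blockWeight_nonneg m j (freqBlock 0))
      · calc _ ≤ (K * |(ξ : ℝ) / 2 ^ j| ^ m) ^ 2 := by gcongr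
          _ = K ^ 2 * (|(ξ : ℝ)| / 2 ^ j) ^ (2 * m) := by rw [habs]; ring
          _ ≤ _ := by
            gcongr
            exact div_pow_le_blockWeight hj0 hne hlt
    calc _ ≤ ‖c ξ‖ ^ 2 * (K ^ 2 * blockWeight m j (freqBlock ξ)) := by gcongr
      _ = _ := by ring
  have hbd : ∀ ξ ∈ L, -((2 : ℤ) ^ j.toNat) < ξ ∧ ξ < (2 : ℤ) ^ j.toNat := by
    intro ξ hξ
    have hlt := not_le.1 (Finset.mem_filter.1 hξ).2
    rw [hNZ] at hlt
    have : |ξ| < (2 : ℤ) ^ j.toNat := by exact_mod_cast hlt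
    exact abs_lt.1 this
  -- The condition `|ξ| < 2^j` alone still admits `ξ` and `ξ - 2^j` together. Within one sign,
  -- differences are smaller than `2^j`, so congruence forces equality; `p` stands for either sign.
  have hsep : ∀ p : ℤ → Prop, (∀ ξ η, p ξ → p η → (0 ≤ ξ ↔ 0 ≤ η)) →
      ∀ T' : Finset ℤ, (∀ ξ ∈ T', ξ ∈ L ∧ p ξ) →
      ∀ ξ ∈ T', ∀ η ∈ T', (2 : ℤ) ^ j.toNat ∣ ξ - η → ξ = η := by
    intro p hp T' hT' ξ hξ η hη hdvd
    obtain ⟨h1, h1'⟩ := hT' ξ hξ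
    obtain ⟨h3, h3'⟩ := hT' η hη
    have h4 := hbd ξ h1
    have h5 := hbd η h3
    have h6 := hp ξ η h1' h3'
    have : |ξ - η| < (2 : ℤ) ^ j.toNat := by
      rw [abs_lt]
      by_cases h : 0 ≤ ξ
      · have := h6.1 h
        constructor <;> omega
      · have : ¬ 0 ≤ η := fun h' => h (h6.2 h')
        constructor <;> omega
    have := Int.eq_zero_of_abs_lt_dvd hdvd this
    omega
  have hlow : ∑ k ∈ idx j, ‖∑ ξ ∈ L, c ξ * (starRingEnd ℂ) (waveletHat ψ j k ξ)‖ ^ 2 ≤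
      2 * K ^ 2 * ∑ ξ ∈ L, ‖c ξ‖ ^ 2 * blockWeight m j (freqBlock ξ) := by
    have hP := sum_sq_analysis_eq_of_incongruent hc h2 hj0 (L.filter fun ξ => 0 ≤ ξ)
      (hsep (fun ξ => 0 ≤ ξ) (fun _ _ h h' => ⟨fun _ => h', fun _ => h⟩) _
        fun ξ hξ => Finset.mem_filter.1 hξ) c
    have hM := sum_sq_analysis_eq_of_incongruent hc h2 hj0 (L.filter fun ξ => ¬ 0 ≤ ξ)
      (hsep (fun ξ => ¬ 0 ≤ ξ) (fun _ _ h h' => ⟨fun h'' => (h h'').elim, fun h'' => (h' h'').elim⟩)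
        _ fun ξ hξ => Finset.mem_filter.1 hξ) c
    have hle : ∑ k ∈ idx j, ‖∑ ξ ∈ L, c ξ * (starRingEnd ℂ) (waveletHat ψ j k ξ)‖ ^ 2 ≤
        2 * ∑ ξ ∈ L, ‖c ξ‖ ^ 2 * ‖fourierLine ψ (ξ / 2 ^ j)‖ ^ 2 := by
      rw [← Finset.sum_filter_add_sum_filter_not L (fun ξ => 0 ≤ ξ)
        (fun ξ => ‖c ξ‖ ^ 2 * ‖fourierLine ψ (ξ / 2 ^ j)‖ ^ 2), ← hP, ← hM, mul_add,
        Finset.mul_sum, Finset.mul_sum, ← Finset.sum_add_distrib]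
      refine Finset.sum_le_sum fun k _ => ?_
      rw [← Finset.sum_filter_add_sum_filter_not L (fun ξ => 0 ≤ ξ)]
      exact sq_norm_add_le _ _
    refine hle.trans ?_
    rw [mul_assoc, Finset.mul_sum L _ (K ^ 2)]
    exact mul_le_mul_of_nonneg_left (Finset.sum_le_sum hpt) zero_le_two
  set A := ∑ ξ ∈ H, ‖c ξ‖ ^ 2 * blockWeight m j (freqBlock ξ)
  set B := ∑ ξ ∈ L, ‖c ξ‖ ^ 2 * blockWeight m j (freqBlock ξ)
  have hA : 0 ≤ A := Finset.sum_nonneg fun ξ _ => hnn ξ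
  have hB : 0 ≤ B := Finset.sum_nonneg fun ξ _ => hnn ξ
  -- Splitting by size and then, for low frequencies, by sign costs a factor two each: hence `2δ`
  -- and `4K²` in `analysisConst`.
  have hsplit : ∑ k ∈ idx j, ‖∑ ξ ∈ T, c ξ * (starRingEnd ℂ) (waveletHat ψ j k ξ)‖ ^ 2 ≤
      2 * (δ * A) + 2 * (2 * K ^ 2 * B) := by
    refine le_trans ?_ (add_le_add (mul_le_mul_of_nonneg_left hhigh zero_le_two)
      (mul_le_mul_of_nonneg_left hlow zero_le_two))
    rw [Finset.mul_sum, Finset.mul_sum, ← Finset.sum_add_distrib]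
    refine Finset.sum_le_sum fun k _ => ?_
    rw [← Finset.sum_filter_add_sum_filter_not T (fun ξ : ℤ => (2 : ℝ) ^ j ≤ |(ξ : ℝ)|)]
    exact sq_norm_add_le _ _
  refine hsplit.trans ?_
  rw [← Finset.sum_filter_add_sum_filter_not T (fun ξ : ℤ => (2 : ℝ) ^ j ≤ |(ξ : ℝ)|)]
  change _ ≤ analysisConst m S δ * (A + B)
  have hδ := δ.coe_nonneg
  have h5 : analysisConst m S δ * (A + B) - (2 * (δ * A) + 2 * (2 * K ^ 2 * B)) =
      A + B + 2 * δ * B + 4 * K ^ 2 * A := by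
    rw [analysisConst, ← hK]; ring
  have h6 : 0 ≤ A + B + 2 * δ * B + 4 * K ^ 2 * A := by positivity
  linarith

/-! ### Tensor products of bounded matrices -/

lemma sum_piFinset_succ {M : Type*} [AddCommMonoid M] {n : ℕ} (T : Fin (n + 1) → Finset ℤ)
    (g : (Fin (n + 1) → ℤ) → M) :
    ∑ ξ ∈ Fintype.piFinset T, g ξ =
      ∑ a ∈ T 0, ∑ b ∈ Fintype.piFinset (fun i => T i.succ), g (Fin.cons a b) := by
  rw [← Finset.sum_product']
  refine Finset.sum_nbij' (fun ξ => (ξ 0, Fin.tail ξ)) (fun p => Fin.cons p.1 p.2) ?_ ?_ ?_ ?_ ?_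
  · intro ξ hξ
    rw [Fintype.mem_piFinset] at hξ
    simp only [Finset.mem_product, Fintype.mem_piFinset]
    exact ⟨hξ 0, fun i => hξ i.succ⟩
  · intro p hp
    simp only [Finset.mem_product, Fintype.mem_piFinset] at hp ⊢
    exact fun i => Fin.cases hp.1 hp.2 i
  · intro ξ _
    exact Fin.cons_self_tail ξ
  · intro p _
    simp
  · intro ξ _
    simp

/-- Induction on `d`: for fixed remaining rows `k'`, the univariate bound is applied in the first
variable to coefficients already summed over the other frequencies; the induction hypothesis then
applies for each first frequency `a`. -/
lemma sum_sq_tensor_le {d : ℕ} {C : ℝ} (hC : 0 ≤ C) (K : Fin d → Finset ℤ)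
    (M : Fin d → ℤ → ℤ → ℂ) (w : Fin d → ℤ → ℝ) (hw : ∀ i ξ, 0 ≤ w i ξ)
    (h : ∀ i (T : Finset ℤ) (c : ℤ → ℂ),
      ∑ k ∈ K i, ‖∑ ξ ∈ T, c ξ * M i k ξ‖ ^ 2 ≤ C * ∑ ξ ∈ T, ‖c ξ‖ ^ 2 * w i ξ)
    (T : Fin d → Finset ℤ) (c : (Fin d → ℤ) → ℂ) :
    ∑ k ∈ Fintype.piFinset K, ‖∑ ξ ∈ Fintype.piFinset T, c ξ * ∏ i, M i (k i) (ξ i)‖ ^ 2 ≤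
      C ^ d * ∑ ξ ∈ Fintype.piFinset T, ‖c ξ‖ ^ 2 * ∏ i, w i (ξ i) := by
  induction d with
  | zero => simp
  | succ n ih =>
    simp only [sum_piFinset_succ, Fin.prod_univ_succ, Fin.cons_zero, Fin.cons_succ]
    set K' := Fintype.piFinset fun i : Fin n => K i.succ
    set T' := Fintype.piFinset fun i : Fin n => T i.succ
    set P : (Fin n → ℤ) → (Fin n → ℤ) → ℂ := fun k ξ => ∏ i, M i.succ (k i) (ξ i)
    set W : (Fin n → ℤ) → ℝ := fun ξ => ∏ i, w i.succ (ξ i)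
    have hih := fun a : ℤ => ih (fun i => K i.succ) (fun i => M i.succ) (fun i => w i.succ)
      (fun i => hw i.succ) (fun i => h i.succ) (fun i => T i.succ)
      (fun b => c (Fin.cons a b : Fin (n + 1) → ℤ))
    calc _ = ∑ k' ∈ K', ∑ k₀ ∈ K 0, ‖∑ a ∈ T 0,
            (∑ b ∈ T', c (Fin.cons a b : Fin (n + 1) → ℤ) * P k' b) * M 0 k₀ a‖ ^ 2 := by
          rw [Finset.sum_comm]
          refine Finset.sum_congr rfl fun k' _ => Finset.sum_congr rfl fun k₀ _ => ?_
          congr 2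
          refine Finset.sum_congr rfl fun a _ => ?_
          rw [Finset.sum_mul]
          refine Finset.sum_congr rfl fun b _ => ?_
          simp only [P]
          ring
      _ ≤ ∑ k' ∈ K', C * ∑ a ∈ T 0,
            ‖∑ b ∈ T', c (Fin.cons a b : Fin (n + 1) → ℤ) * P k' b‖ ^ 2 * w 0 a :=
          Finset.sum_le_sum fun k' _ => h 0 _ _
      _ = C * ∑ a ∈ T 0, w 0 a * ∑ k' ∈ K',
            ‖∑ b ∈ T', c (Fin.cons a b : Fin (n + 1) → ℤ) * P k' b‖ ^ 2 := by
          rw [← Finset.mul_sum, Finset.sum_comm]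
          congr 1
          refine Finset.sum_congr rfl fun a _ => ?_
          rw [← Finset.sum_mul, mul_comm]
      _ ≤ C * ∑ a ∈ T 0, w 0 a * (C ^ n * ∑ b ∈ T',
            ‖c (Fin.cons a b : Fin (n + 1) → ℤ)‖ ^ 2 * W b) := by
          refine mul_le_mul_of_nonneg_left (Finset.sum_le_sum fun a _ => ?_) hC
          exact mul_le_mul_of_nonneg_left (hih a) (hw 0 a)
      _ = _ := by
          rw [pow_succ', mul_assoc C, Finset.mul_sum (T 0) _ (C ^ n)]
          congr 1
          refine Finset.sum_congr rfl fun a _ => ?_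
          rw [mul_left_comm, Finset.mul_sum (T') _ (w 0 a)]
          congr 1
          refine Finset.sum_congr rfl fun b _ => ?_
          simp only [W]
          ring

/-! ### Multivariate wavelet coefficients -/

lemma memLp_multiPsiPer {d : ℕ} {ψ : ℝ → ℝ} (hc : HasCompactSupport ψ) (h2 : MemLp ψ 2 volume)
    (j k : Fin d → ℤ) :
    MemLp (fun x => (multiPsiPer ψ j k x : ℂ)) 2 (torusMeasure d) := by
  have h : ∀ i, MemLp (fun x => (psiPer ψ (j i) (k i) x : ℂ)) 2 circleMeasure := fun i =>
    memLp_psiPer hc h2 (j i) (k i)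
  have hint : Integrable (fun x : UnitAddTorus (Fin d) => ∏ i, (psiPer ψ (j i) (k i) (x i) : ℂ))
      (torusMeasure d) :=
    Integrable.fintype_prod (μ := fun _ => circleMeasure)
      (f := fun i (x : UnitAddCircle) => (psiPer ψ (j i) (k i) x : ℂ))
      fun i => (h i).integrable (by norm_num)
  have heq : (fun x => (multiPsiPer ψ j k x : ℂ)) = fun x : UnitAddTorus (Fin d) =>
      ∏ i, (psiPer ψ (j i) (k i) (x i) : ℂ) := by
    funext x
    simp [multiPsiPer]
  rw [heq, memLp_two_iff_integrable_sq_norm hint.1]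
  simp_rw [norm_prod, ← Finset.prod_pow]
  exact Integrable.fintype_prod (μ := fun _ => circleMeasure)
    (f := fun i (x : UnitAddCircle) => ‖(psiPer ψ (j i) (k i) x : ℂ)‖ ^ 2)
    fun i => (memLp_two_iff_integrable_sq_norm (h i).1).1 (h i)

lemma mFourierCoeff_eq {d : ℕ} (f : UnitAddTorus (Fin d) → ℂ) (n : Fin d → ℤ) :
    UnitAddTorus.mFourierCoeff f n =
      ∫ t, UnitAddTorus.mFourier (-n) t * f t ∂(torusMeasure d) := rfl

lemma mFourierCoeff_congr_ae {d : ℕ} {f g : UnitAddTorus (Fin d) → ℂ}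
    (h : f =ᵐ[torusMeasure d] g) (n : Fin d → ℤ) :
    UnitAddTorus.mFourierCoeff f n = UnitAddTorus.mFourierCoeff g n := by
  rw [mFourierCoeff_eq, mFourierCoeff_eq]
  exact integral_congr_ae (h.mono fun x hx => by simp only [hx])

lemma mFourierCoeff_multiPsiPer {d : ℕ} (ψ : ℝ → ℝ) (j k n : Fin d → ℤ) :
    UnitAddTorus.mFourierCoeff (fun x => (multiPsiPer ψ j k x : ℂ)) n =
      ∏ i, waveletHat ψ (j i) (k i) (n i) := by
  rw [mFourierCoeff_eq]
  simp only [multiPsiPer, UnitAddTorus.mFourier, ContinuousMap.coe_mk, Complex.ofReal_prod,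
    ← Finset.prod_mul_distrib]
  exact integral_fintype_prod_eq_prod (μ := fun _ => circleMeasure)
    (fun i (x : UnitAddCircle) => fourier ((-n) i) x * (psiPer ψ (j i) (k i) x : ℂ))

lemma hasSum_mFourierCoeff_mul_conj {d : ℕ} {f g : UnitAddTorus (Fin d) → ℂ}
    (hf : MemLp f 2 (torusMeasure d)) (hg : MemLp g 2 (torusMeasure d)) :
    HasSum (fun n => UnitAddTorus.mFourierCoeff f n *
      (starRingEnd ℂ) (UnitAddTorus.mFourierCoeff g n)) (torusInner f g) := by
  have h := UnitAddTorus.hasSum_prod_mFourierCoeff (hg.toLp g) (hf.toLp f)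
  convert h using 1
  · funext n
    rw [mul_comm, mFourierCoeff_congr_ae hf.coeFn_toLp, mFourierCoeff_congr_ae hg.coeFn_toLp]
  · unfold torusInner
    refine integral_congr_ae ?_
    filter_upwards [hf.coeFn_toLp, hg.coeFn_toLp] with x hx hx'
    rw [hx, hx', mul_comm]

lemma tsum_sq_mFourierCoeff_le {d : ℕ} {f : UnitAddTorus (Fin d) → ℂ}
    (hf : MemLp f 2 (torusMeasure d)) :
    ∑' n, ‖UnitAddTorus.mFourierCoeff f n‖ₑ ^ 2 ≤ eLpNorm f 2 (torusMeasure d) ^ 2 := by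
  rw [ENNReal.tsum_eq_iSup_sum]
  refine iSup_le fun A => ?_
  have h := (UnitAddTorus.orthonormal_mFourier (d := Fin d)).sum_inner_products_le
    (hf.toLp f) (s := A)
  have hnorm : ‖hf.toLp f‖ = (eLpNorm f 2 (torusMeasure d)).toReal := Lp.norm_toLp f hf
  rw [hnorm] at h
  have h1 : ∀ n, inner ℂ (UnitAddTorus.mFourierLp 2 n) (hf.toLp f) =
      UnitAddTorus.mFourierCoeff f n := by
    intro n
    rw [← congrFun UnitAddTorus.coe_mFourierBasis n, ← HilbertBasis.repr_apply_apply,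
      UnitAddTorus.mFourierBasis_repr]
    exact mFourierCoeff_congr_ae hf.coeFn_toLp n
  have h3 := ENNReal.ofReal_le_ofReal h
  rw [ENNReal.ofReal_sum_of_nonneg fun _ _ => by positivity,
    ENNReal.ofReal_pow ENNReal.toReal_nonneg, ENNReal.ofReal_toReal hf.2.ne] at h3
  refine le_trans (le_of_eq (Finset.sum_congr rfl fun n _ => ?_)) h3
  rw [ENNReal.ofReal_pow (norm_nonneg _), ofReal_norm]
  exact congrArg (fun z => ‖z‖ₑ ^ 2) (h1 n).symm

/-- The weighted bound for the multivariate analysis operators. -/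
lemma sum_sq_coeff_le {d : ℕ} {ψ : ℝ → ℝ} {S : ℝ} {γ δ : ℝ≥0} {m : ℕ} (hm0 : 0 < m)
    (h2 : MemLp ψ 2 volume) (hS : HasSupport ψ S) (hm : HasVanishingMoments ψ m)
    (hR : IsRieszOnLevels ψ γ δ) {f : UnitAddTorus (Fin d) → ℂ}
    (hf : MemLp f 2 (torusMeasure d)) (j : Level d) :
    ∑ k ∈ multiIdx j.1, ‖coeff ψ f j.1 k‖ₑ ^ 2 ≤
      ENNReal.ofReal (analysisConst m S δ ^ d) * ∑' n : Fin d → ℤ,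
        ‖UnitAddTorus.mFourierCoeff f n‖ₑ ^ 2 *
          ∏ i, ENNReal.ofReal (blockWeight m (j.1 i) (freqBlock (n i))) := by
  have hC : 0 ≤ analysisConst m S δ := by unfold analysisConst; positivity
  set F := UnitAddTorus.mFourierCoeff f with hF
  set P : (Fin d → ℤ) → (Fin d → ℤ) → ℂ := fun k n =>
    ∏ i, (starRingEnd ℂ) (waveletHat ψ (j.1 i) (k i) (n i)) with hP
  have hsum : ∀ k, HasSum (fun n => F n * P k n) (coeff ψ f j.1 k) := by
    intro k
    have h := hasSum_mFourierCoeff_mul_conj hf (memLp_multiPsiPer hS.hasCompactSupport h2 j.1 k)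
    simp only [mFourierCoeff_multiPsiPer, map_prod] at h
    exact h
  -- Each coefficient is the limit of its Fourier partial sums, so a bound uniform over finite sets
  -- of frequencies suffices.
  have htend : Filter.Tendsto (fun A : Finset (Fin d → ℤ) =>
      ∑ k ∈ multiIdx j.1, ‖∑ n ∈ A, F n * P k n‖ₑ ^ 2) Filter.atTop
      (nhds (∑ k ∈ multiIdx j.1, ‖coeff ψ f j.1 k‖ₑ ^ 2)) := by
    refine tendsto_finsetSum _ fun k _ => ?_
    exact ((ENNReal.continuous_pow 2).comp continuous_enorm).continuousAt.tendsto.comp (hsum k)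
  refine le_of_tendsto' htend fun A => ?_
  classical
  -- The tensor bound needs a box of frequencies: `A` is enclosed in the product of its projections
  -- and the coefficients are extended by zero.
  set T : Fin d → Finset ℤ := fun i => A.image fun n => n i with hT
  have hAT : A ⊆ Fintype.piFinset T := fun n hn => by
    rw [Fintype.mem_piFinset]
    exact fun i => Finset.mem_image_of_mem _ hn
  have h := sum_sq_tensor_le hC (fun i => idx (j.1 i))
    (fun i k n => (starRingEnd ℂ) (waveletHat ψ (j.1 i) k n))
    (fun i n => blockWeight m (j.1 i) (freqBlock n)) (fun i n => blockWeight_nonneg _ _ _)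
    (fun i => sum_sq_analysis_le_weight hm0 h2 hS hm hR (j.2 i)) T
    (fun n => if n ∈ A then F n else 0)
  simp only [ite_mul, zero_mul, apply_ite (fun z : ℂ => ‖z‖ ^ 2), norm_zero, ne_eq,
    OfNat.ofNat_ne_zero, not_false_eq_true, zero_pow, ← Finset.sum_filter,
    Finset.filter_mem_eq_inter, Finset.inter_eq_right.2 hAT] at h
  have h' := ENNReal.ofReal_le_ofReal h
  rw [ENNReal.ofReal_mul (by positivity), ENNReal.ofReal_sum_of_nonneg fun _ _ => by positivity,
    ENNReal.ofReal_sum_of_nonneg fun n _ => mul_nonneg (by positivity)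
      (Finset.prod_nonneg fun i _ => blockWeight_nonneg _ _ _)] at h'
  have hsq : ∀ z : ℂ, ENNReal.ofReal (‖z‖ ^ 2) = ‖z‖ₑ ^ 2 := fun z => by
    rw [ENNReal.ofReal_pow (norm_nonneg _), ofReal_norm]
  simp only [hsq] at h'
  refine h'.trans ?_
  gcongr
  refine le_trans (le_of_eq (Finset.sum_congr rfl fun n _ => ?_)) (ENNReal.sum_le_tsum A)
  rw [ENNReal.ofReal_mul (by positivity), hsq,
    ENNReal.ofReal_prod_of_nonneg fun i _ => blockWeight_nonneg _ _ _]

/-! ### Differences and Fourier coefficients -/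

lemma mFourierCoeff_comp_add {d : ℕ} (f : UnitAddTorus (Fin d) → ℂ) (v : UnitAddTorus (Fin d))
    (n : Fin d → ℤ) :
    UnitAddTorus.mFourierCoeff (fun x => f (x + v)) n =
      UnitAddTorus.mFourier n v * UnitAddTorus.mFourierCoeff f n := by
  rw [mFourierCoeff_eq, mFourierCoeff_eq, ← integral_const_mul,
    ← integral_add_right_eq_self (fun t => UnitAddTorus.mFourier n v *
      (UnitAddTorus.mFourier (-n) t * f t)) v]
  congr 1
  funext t
  have : UnitAddTorus.mFourier n v * UnitAddTorus.mFourier (-n) (t + v) =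
      UnitAddTorus.mFourier (-n) t := by
    simp only [UnitAddTorus.mFourier, ContinuousMap.coe_mk, ← Finset.prod_mul_distrib]
    refine Finset.prod_congr rfl fun i _ => ?_
    simp only [Pi.neg_apply, Pi.add_apply, fourier_apply, ← Circle.coe_mul, ← AddCircle.toCircle_add]
    congr 2
    simp only [neg_smul, smul_add]
    abel
  rw [← mul_assoc, this]

lemma update_add_eq {d : ℕ} (x : UnitAddTorus (Fin d)) (i : Fin d) (a : UnitAddCircle) :
    Function.update x i (x i + a) = x + Pi.single i a := by
  funext l
  rcases eq_or_ne l i with rfl | h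
  · simp
  · simp [h]

lemma mFourier_pi_single {d : ℕ} (n : Fin d → ℤ) (i : Fin d) (a : UnitAddCircle) :
    UnitAddTorus.mFourier n (Pi.single i a) = fourier (n i) a := by
  simp only [UnitAddTorus.mFourier, ContinuousMap.coe_mk]
  rw [Finset.prod_eq_single i]
  · simp
  · intro l _ h
    simp [h]
  · simp

lemma memLp_comp_add {d : ℕ} {f : UnitAddTorus (Fin d) → ℂ} (hf : MemLp f 2 (torusMeasure d))
    (v : UnitAddTorus (Fin d)) : MemLp (fun x => f (x + v)) 2 (torusMeasure d) :=
  hf.comp_measurePreserving (measurePreserving_add_right (torusMeasure d) v)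

lemma memLp_coordDiff {d : ℕ} {f : UnitAddTorus (Fin d) → ℂ} (hf : MemLp f 2 (torusMeasure d))
    (r : ℕ) (h : ℝ) (i : Fin d) : MemLp (coordDiff r h i f) 2 (torusMeasure d) := by
  unfold coordDiff
  simp_rw [update_add_eq]
  exact memLp_finsetSum _ fun l _ => (memLp_comp_add hf _).const_mul _

/-- A translation multiplies the coefficient by a character; the binomial theorem collects the
difference into a power. -/
lemma mFourierCoeff_coordDiff {d : ℕ} {f : UnitAddTorus (Fin d) → ℂ}
    (hf : MemLp f 2 (torusMeasure d)) (r : ℕ) (h : ℝ) (i : Fin d) (n : Fin d → ℤ) :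
    UnitAddTorus.mFourierCoeff (coordDiff r h i f) n =
      (fourier (n i) (h : UnitAddCircle) - 1) ^ r * UnitAddTorus.mFourierCoeff f n := by
  have hint : ∀ l : ℕ, Integrable (fun t => UnitAddTorus.mFourier (-n) t *
      ((-1 : ℂ) ^ (r - l) * (r.choose l : ℂ) *
        f (t + Pi.single i (((l : ℝ) * h : ℝ) : UnitAddCircle)))) (torusMeasure d) := by
    intro l
    refine (((memLp_comp_add hf _).const_mul _).integrable (by norm_num)).bdd_mul (c := 1)
      (ContinuousMap.continuous _).aestronglyMeasurable (Filter.Eventually.of_forall fun t => ?_)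
    exact (ContinuousMap.norm_coe_le_norm _ t).trans UnitAddTorus.mFourier_norm.le
  have hpow : ∀ l : ℕ, (fourier (n i) (((l : ℝ) * h : ℝ) : UnitAddCircle) : ℂ) =
      (fourier (n i) (h : UnitAddCircle)) ^ l := by
    intro l
    rw [fourier_coe_apply, fourier_coe_apply, ← Complex.exp_nat_mul]
    congr 1
    push_cast
    ring
  rw [mFourierCoeff_eq]
  simp only [coordDiff, update_add_eq, Finset.mul_sum]
  rw [integral_finsetSum _ fun l _ => hint l, sub_eq_add_neg, add_pow, Finset.sum_mul]
  refine Finset.sum_congr rfl fun l _ => ?_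
  simp_rw [mul_left_comm _ ((-1 : ℂ) ^ (r - l) * (r.choose l : ℂ))]
  have htrans := mFourierCoeff_comp_add f (Pi.single i (((l : ℝ) * h : ℝ) : UnitAddCircle)) n
  rw [mFourierCoeff_eq, mFourier_pi_single, hpow] at htrans
  rw [integral_const_mul, htrans]
  ring

lemma foldr_coordDiff {d : ℕ} {f : UnitAddTorus (Fin d) → ℂ} (hf : MemLp f 2 (torusMeasure d))
    (r : ℕ) (h : Fin d → ℝ) (L : List (Fin d)) :
    MemLp (L.foldr (fun i g => coordDiff r (h i) i g) f) 2 (torusMeasure d) ∧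
    ∀ n : Fin d → ℤ, (∀ i ∈ L, 1 ≤ ‖(fourier (n i) (h i : UnitAddCircle) : ℂ) - 1‖) →
      ‖UnitAddTorus.mFourierCoeff f n‖ₑ ≤
        ‖UnitAddTorus.mFourierCoeff (L.foldr (fun i g => coordDiff r (h i) i g) f) n‖ₑ := by
  induction L with
  | nil => exact ⟨hf, fun _ _ => le_rfl⟩
  | cons i L ih =>
    refine ⟨memLp_coordDiff ih.1 r (h i) i, fun n hn => ?_⟩
    rw [List.foldr_cons, mFourierCoeff_coordDiff ih.1, enorm_mul, enorm_pow]
    refine (ih.2 n fun l hl => hn l (List.mem_cons_of_mem _ hl)).trans ?_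
    refine le_mul_of_one_le_left' (one_le_pow₀ ?_)
    rw [← ofReal_norm, ← ENNReal.ofReal_one]
    exact ENNReal.ofReal_le_ofReal (hn i List.mem_cons_self)

/-- Between a quarter turn and a half turn the cosine is nonpositive, so the real part is already at
most `-1`. -/
lemma one_le_norm_fourier_sub_one {n : ℤ} {h : ℝ} (h1 : 1 / 4 ≤ |(n : ℝ) * h|)
    (h2 : |(n : ℝ) * h| ≤ 1 / 2) : 1 ≤ ‖(fourier n (h : UnitAddCircle) : ℂ) - 1‖ := by
  have he : (fourier n (h : UnitAddCircle) : ℂ) =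
      Complex.exp ((2 * Real.pi * (n * h) : ℝ) * Complex.I) := by
    rw [fourier_coe_apply]
    congr 1
    push_cast
    ring
  have hcos : Real.cos (2 * Real.pi * (n * h)) ≤ 0 := by
    rw [← Real.cos_abs, abs_mul, abs_of_pos (by positivity : 0 < 2 * Real.pi)]
    have := Real.pi_pos
    apply Real.cos_nonpos_of_pi_div_two_le_of_le <;> nlinarith
  have h3 := Complex.abs_re_le_norm ((fourier n (h : UnitAddCircle) : ℂ) - 1)
  rw [he, Complex.sub_re, Complex.exp_ofReal_mul_I_re, Complex.one_re] at h3
  rw [he]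
  refine le_trans ?_ h3
  rw [abs_of_nonpos (by linarith)]
  linarith

/-- The squared smoothness weight of level `j`. -/
def levelWeight (s : ℝ) (j : ℤ) : ℝ := if 0 ≤ j then (2 : ℝ) ^ (2 * (j : ℝ) * s) else 1

lemma levelWeight_pos (s : ℝ) (j : ℤ) : 0 < levelWeight s j := by
  unfold levelWeight
  split_ifs <;> positivity

/-- The Besov norm controls the dyadic blocks of the Fourier series. -/
lemma levelWeight_mul_block_le {d r : ℕ} {s : ℝ} (hs : 0 < s) {f : UnitAddTorus (Fin d) → ℂ}
    (hf : MemLp f 2 (torusMeasure d)) (b : Fin d → ℤ) :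
    ENNReal.ofReal (∏ i, levelWeight s (b i)) *
      ∑' n : Fin d → ℤ, (if (fun i => freqBlock (n i)) = b then
        ‖UnitAddTorus.mFourierCoeff f n‖ₑ ^ 2 else 0) ≤ besovMixNorm r s f ^ 2 := by
  classical
  set u : Finset (Fin d) := Finset.univ.filter fun i => 0 ≤ b i with hu
  -- With this step `|n i * h i|` lies in `[1/4, 1/2]` on the block. Coordinates with `b i < 0` have
  -- weight one and are not differenced.
  set h : Fin d → ℝ := fun i => (2 : ℝ) ^ (-(b i) - 2) with hh
  have hhpos : ∀ i, 0 < h i := fun i => by positivity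
  have hh1 : ∀ i ∈ u, 0 < |h i| ∧ |h i| ≤ 1 := by
    intro i hi
    have hb : 0 ≤ b i := (Finset.mem_filter.1 hi).2
    rw [abs_of_pos (hhpos i)]
    exact ⟨hhpos i, zpow_le_one_of_nonpos₀ (by norm_num) (by omega)⟩
  have hfold := foldr_coordDiff hf r h u.sort
  change MemLp (mixedDiff r u h f) 2 (torusMeasure d) ∧ _ at hfold
  have hmult : ∀ n : Fin d → ℤ, (fun i => freqBlock (n i)) = b → ∀ i ∈ u.sort,
      1 ≤ ‖(fourier (n i) (h i : UnitAddCircle) : ℂ) - 1‖ := by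
    intro n hn i hi
    rw [Finset.mem_sort] at hi
    have hb : 0 ≤ b i := (Finset.mem_filter.1 hi).2
    have hni : freqBlock (n i) = b i := congrFun hn i
    have hne : n i ≠ 0 := fun h0 => by
      rw [freqBlock_eq_neg_one_iff.2 h0] at hni
      omega
    have h1 := two_zpow_freqBlock_le hne
    have h2 := lt_two_zpow_freqBlock (n i)
    rw [hni] at h1 h2
    have h3 : |(n i : ℝ) * h i| = |(n i : ℝ)| * h i := by rw [abs_mul, abs_of_pos (hhpos i)]
    have h4 : (2 : ℝ) ^ b i * h i = 1 / 4 := by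
      rw [hh, ← zpow_add₀ (by norm_num), show b i + (-(b i) - 2) = -2 by ring]
      norm_num
    have h5 : (2 : ℝ) ^ (b i + 1) * h i = 1 / 2 := by
      rw [zpow_add_one₀ (by norm_num), mul_right_comm, h4]
      norm_num
    apply one_le_norm_fourier_sub_one <;> rw [h3]
    · rw [← h4]
      exact mul_le_mul_of_nonneg_right h1 (hhpos i).le
    · rw [← h5]
      exact mul_le_mul_of_nonneg_right h2.le (hhpos i).le
  have hblock : ∑' n : Fin d → ℤ, (if (fun i => freqBlock (n i)) = b then
      ‖UnitAddTorus.mFourierCoeff f n‖ₑ ^ 2 else 0) ≤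
        eLpNorm (mixedDiff r u h f) 2 (torusMeasure d) ^ 2 := by
    refine le_trans (ENNReal.tsum_le_tsum fun n => ?_) (tsum_sq_mFourierCoeff_le hfold.1)
    split_ifs with hn
    · exact pow_le_pow_left' (hfold.2 n (hmult n hn)) 2
    · exact zero_le
  -- Here `|h i|^(-s) = 2^((b i + 2)s)`; the surplus `2^(2s)` per coordinate is discarded.
  have hw : ENNReal.ofReal (∏ i, levelWeight s (b i)) ≤
      ENNReal.ofReal (∏ i ∈ u, |h i| ^ (-s)) ^ 2 := by
    rw [← ENNReal.ofReal_pow (Finset.prod_nonneg fun i _ => by positivity), ← Finset.prod_pow]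
    refine ENNReal.ofReal_le_ofReal ?_
    simp only [levelWeight]
    rw [← Finset.prod_filter]
    refine Finset.prod_le_prod (fun i _ => by positivity) fun i hi => ?_
    rw [abs_of_pos (hhpos i)]
    simp only [hh]
    rw [← Real.rpow_intCast, ← Real.rpow_mul (by norm_num),
      ← Real.rpow_natCast, ← Real.rpow_mul (by norm_num)]
    refine Real.rpow_le_rpow_of_exponent_le (by norm_num) ?_
    push_cast
    nlinarith
  have hB : ENNReal.ofReal (∏ i ∈ u, |h i| ^ (-s)) *
      eLpNorm (mixedDiff r u h f) 2 (torusMeasure d) ≤ besovMixNorm r s f := by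
    refine le_trans ?_ (Finset.single_le_sum (f := fun u => besovSeminorm r s u f)
      (fun _ _ => zero_le) (Finset.mem_univ u))
    exact le_iSup₂_of_le (f := fun (h : Fin d → ℝ) (_ : ∀ i ∈ u, 0 < |h i| ∧ |h i| ≤ 1) =>
      ENNReal.ofReal (∏ i ∈ u, |h i| ^ (-s)) * eLpNorm (mixedDiff r u h f) 2 (torusMeasure d))
      h hh1 le_rfl
  calc _ ≤ ENNReal.ofReal (∏ i ∈ u, |h i| ^ (-s)) ^ 2 *
        eLpNorm (mixedDiff r u h f) 2 (torusMeasure d) ^ 2 := mul_le_mul' hw hblock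
    _ = (ENNReal.ofReal (∏ i ∈ u, |h i| ^ (-s)) *
        eLpNorm (mixedDiff r u h f) 2 (torusMeasure d)) ^ 2 := (mul_pow _ _ _).symm
    _ ≤ _ := pow_le_pow_left' hB 2

/-! ### Summation over levels and blocks -/

/-- The convolution kernel that compares levels with dyadic blocks. -/
def levelKernel (m : ℕ) (s : ℝ) (t : ℤ) : ℝ :=
  (2 : ℝ) ^ (2 * (t : ℝ) * s) * min 1 ((2 : ℝ) ^ (2 * (m : ℤ) * (1 - t)))

lemma levelKernel_nonneg (m : ℕ) (s : ℝ) (t : ℤ) : 0 ≤ levelKernel m s t := by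
  unfold levelKernel
  positivity

/-- The right tail is of order `2^(2t(s-m))`, summable by `s < m`; the left tail is at most
`2^(2ts)`, summable by `0 < s`. -/
lemma summable_levelKernel {m : ℕ} {s : ℝ} (hs : 0 < s) (hsm : s < m) :
    Summable (levelKernel m s) := by
  have hgeom : ∀ a : ℝ, a < 0 → Summable fun n : ℕ => ((2 : ℝ) ^ a) ^ n := fun a ha =>
    summable_geometric_of_lt_one (by positivity)
      (Real.rpow_lt_one_of_one_lt_of_neg (by norm_num) ha)
  refine Summable.of_nat_of_neg ?_ ?_
  · refine ((hgeom (2 * (s - m)) (by linarith)).mul_left ((2 : ℝ) ^ (2 * (m : ℝ)))).of_nonneg_of_le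
      (fun n => levelKernel_nonneg _ _ _) fun n => ?_
    calc levelKernel m s n ≤ (2 : ℝ) ^ (2 * ((n : ℤ) : ℝ) * s) *
          (2 : ℝ) ^ (2 * (m : ℤ) * (1 - (n : ℤ))) := by
          unfold levelKernel
          gcongr
          exact min_le_right _ _
      _ = _ := by
          rw [← Real.rpow_intCast, ← Real.rpow_natCast, ← Real.rpow_mul (by norm_num),
            ← Real.rpow_add (by norm_num), ← Real.rpow_add (by norm_num)]
          congr 1
          push_cast
          ring
  · refine (hgeom (-(2 * s)) (by linarith)).of_nonneg_of_le
      (fun n => levelKernel_nonneg _ _ _) fun n => ?_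
    calc levelKernel m s (-(n : ℤ)) ≤ (2 : ℝ) ^ (2 * ((-(n : ℤ) : ℤ) : ℝ) * s) * 1 := by
          unfold levelKernel
          gcongr
          exact min_le_left _ _
      _ = _ := by
          rw [mul_one, ← Real.rpow_natCast, ← Real.rpow_mul (by norm_num)]
          congr 1
          push_cast
          ring

/-- For `j, n ≥ 0` this is an identity, `2^(2js) = 2^(2ns) · 2^(2(j-n)s)`; the pair `(-1, -1)` only
needs the kernel to be at least one at zero. -/
lemma levelWeight_mul_blockWeight_le (m : ℕ) (s : ℝ) (j n : ℤ) :
    levelWeight s j * blockWeight m j n ≤ levelWeight s n * levelKernel m s (j - n) := by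
  unfold blockWeight
  split_ifs with h1 h2
  · obtain ⟨rfl, rfl⟩ := h1
    simp only [levelWeight, levelKernel, sub_self, Int.cast_zero, mul_zero, zero_mul,
      Real.rpow_zero, sub_zero, mul_one, one_mul]
    rw [if_neg (by norm_num), one_mul]
    exact le_min le_rfl (one_le_zpow₀ (by norm_num) (by positivity))
  · rw [levelWeight, levelWeight, if_pos h2.1, if_pos h2.2, levelKernel, ← mul_assoc,
      ← Real.rpow_add (by norm_num)]
    refine le_of_eq ?_
    congr 2
    · push_cast
      ring
    · congr 2
      ring
  · rw [mul_zero]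
    exact mul_nonneg (levelWeight_pos _ _).le (levelKernel_nonneg _ _ _)

lemma tsum_ofReal_levelKernel {m : ℕ} {s : ℝ} (hs : 0 < s) (hsm : s < m) :
    ∑' t, ENNReal.ofReal (levelKernel m s t) = ENNReal.ofReal (∑' t, levelKernel m s t) :=
  (ENNReal.ofReal_tsum_of_nonneg (levelKernel_nonneg m s) (summable_levelKernel hs hsm)).symm

lemma tsum_levels_le {m : ℕ} {s : ℝ} (hs : 0 < s) (hsm : s < m) (n : ℤ) :
    ∑' j, ENNReal.ofReal (levelWeight s j * blockWeight m j n) ≤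
      ENNReal.ofReal (∑' t, levelKernel m s t) * ENNReal.ofReal (levelWeight s n) := by
  rw [mul_comm, ← tsum_ofReal_levelKernel hs hsm, ← ENNReal.tsum_mul_left,
    ← (Equiv.subRight n).tsum_eq fun t =>
      ENNReal.ofReal (levelWeight s n) * ENNReal.ofReal (levelKernel m s t)]
  refine ENNReal.tsum_le_tsum fun j => ?_
  rw [← ENNReal.ofReal_mul (levelWeight_pos _ _).le]
  exact ENNReal.ofReal_le_ofReal (levelWeight_mul_blockWeight_le m s j n)

/-- The inverse weight is what the Besov norm supplies as decay of the block energies. -/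
lemma tsum_blocks_le {m : ℕ} {s : ℝ} (hs : 0 < s) (hsm : s < m) (j : ℤ) :
    ∑' n, ENNReal.ofReal (levelWeight s j * blockWeight m j n * (levelWeight s n)⁻¹) ≤
      ENNReal.ofReal (∑' t, levelKernel m s t) := by
  rw [← tsum_ofReal_levelKernel hs hsm,
    ← (Equiv.subLeft j).tsum_eq fun t => ENNReal.ofReal (levelKernel m s t)]
  refine ENNReal.tsum_le_tsum fun n => ENNReal.ofReal_le_ofReal ?_
  rw [← div_eq_mul_inv, div_le_iff₀' (levelWeight_pos s n)]
  exact levelWeight_mul_blockWeight_le m s j n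

lemma levelWeight_freqBlock_le {s : ℝ} (hs : 0 < s) (n : ℤ) :
    levelWeight s (freqBlock n) ≤ (1 + (n : ℝ) ^ 2) ^ s := by
  rcases eq_or_ne n 0 with rfl | hn
  · simp [freqBlock, levelWeight]
  · rw [levelWeight, if_pos (freqBlock_nonneg hn), Real.rpow_mul (by norm_num), mul_comm (2 : ℝ),
      Real.rpow_mul (by norm_num), Real.rpow_intCast, Real.rpow_two]
    have h := two_zpow_freqBlock_le hn
    refine Real.rpow_le_rpow (by positivity) ?_ hs.le
    calc _ ≤ |(n : ℝ)| ^ 2 := by gcongr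
      _ ≤ _ := by rw [sq_abs]; linarith

lemma tsum_pi_prod {d : ℕ} (g : Fin d → ℤ → ℝ≥0∞) :
    ∑' n : Fin d → ℤ, ∏ i, g i (n i) = ∏ i, ∑' a, g i a := by
  induction d with
  | zero => simp
  | succ e ih =>
    rw [← (Fin.consEquiv fun _ => ℤ).tsum_eq, ENNReal.tsum_prod', Fin.prod_univ_succ,
      ← ih fun i => g i.succ, ← ENNReal.tsum_mul_right]
    refine tsum_congr fun a => ?_
    rw [← ENNReal.tsum_mul_left]
    refine tsum_congr fun b => ?_
    simp [Fin.consEquiv, Fin.prod_univ_succ]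

lemma prod_levelWeight {d : ℕ} (s : ℝ) (j : Fin d → ℤ) :
    ∏ i, levelWeight s (j i) = (2 : ℝ) ^ (2 * (levelNorm j : ℝ) * s) := by
  simp only [levelWeight]
  rw [← Finset.prod_filter, ← Real.rpow_sum_of_pos (by norm_num), levelNorm, Int.cast_sum,
    Finset.mul_sum, Finset.sum_mul]

/-- The square of the constant in the main theorem. -/
def mainConst (d m : ℕ) (s S : ℝ) (δ : ℝ≥0) : ℝ≥0∞ :=
  ENNReal.ofReal (analysisConst m S δ ^ d) * ENNReal.ofReal (∑' t, levelKernel m s t) ^ d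

/-- The squared form of the estimate for Sobolev norms. -/
lemma tsum_levels_coeff_le {d m : ℕ} {s : ℝ} (hs : 0 < s) (hsm : s < m) {S : ℝ} {γ δ : ℝ≥0}
    {ψ : ℝ → ℝ} (h2 : MemLp ψ 2 volume) (hS : HasSupport ψ S) (hm : HasVanishingMoments ψ m)
    (hR : IsRieszOnLevels ψ γ δ) {f : UnitAddTorus (Fin d) → ℂ}
    (hf : MemLp f 2 (torusMeasure d)) :
    ∑' j : Level d, ENNReal.ofReal ((2 : ℝ) ^ (2 * (levelNorm j.1 : ℝ) * s)) *
        ∑ k ∈ multiIdx j.1, ‖coeff ψ f j.1 k‖ₑ ^ 2 ≤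
      mainConst d m s S δ * ∑' n : Fin d → ℤ, ‖UnitAddTorus.mFourierCoeff f n‖ₑ ^ 2 *
        ∏ i, ENNReal.ofReal ((1 + (n i : ℝ) ^ 2) ^ s) := by
  have hm0 : 0 < m := by exact_mod_cast hs.trans hsm
  set F := UnitAddTorus.mFourierCoeff f
  set A := ENNReal.ofReal (analysisConst m S δ ^ d) with hA
  set κ := ENNReal.ofReal (∑' t, levelKernel m s t) with hκ
  calc _ ≤ ∑' j : Level d, A * ∑' n : Fin d → ℤ, ‖F n‖ₑ ^ 2 *
          ∏ i, ENNReal.ofReal (levelWeight s (j.1 i) *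
            blockWeight m (j.1 i) (freqBlock (n i))) := by
        refine ENNReal.tsum_le_tsum fun j => ?_
        refine (mul_le_mul_right (sum_sq_coeff_le hm0 h2 hS hm hR hf j) _).trans (le_of_eq ?_)
        rw [mul_left_comm, ← ENNReal.tsum_mul_left]
        congr 1
        refine tsum_congr fun n => ?_
        rw [mul_left_comm, ← prod_levelWeight,
          ENNReal.ofReal_prod_of_nonneg fun i _ => (levelWeight_pos _ _).le,
          ← Finset.prod_mul_distrib]
        congr 1
        refine Finset.prod_congr rfl fun i _ => ?_
        rw [ENNReal.ofReal_mul (levelWeight_pos _ _).le]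
    -- Enlarging the sum to all of `ℤ^d` lets it factor over the coordinates.
    _ ≤ ∑' j : Fin d → ℤ, A * ∑' n : Fin d → ℤ, ‖F n‖ₑ ^ 2 *
          ∏ i, ENNReal.ofReal (levelWeight s (j i) * blockWeight m (j i) (freqBlock (n i))) :=
        ENNReal.tsum_comp_le_tsum_of_injective Subtype.val_injective
          (fun j : Fin d → ℤ => A * ∑' n : Fin d → ℤ, ‖F n‖ₑ ^ 2 *
          ∏ i, ENNReal.ofReal (levelWeight s (j i) * blockWeight m (j i) (freqBlock (n i))))
    _ = A * ∑' n : Fin d → ℤ, ‖F n‖ₑ ^ 2 * ∏ i, ∑' j,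
          ENNReal.ofReal (levelWeight s j * blockWeight m j (freqBlock (n i))) := by
        rw [ENNReal.tsum_mul_left, ENNReal.tsum_comm]
        congr 1
        refine tsum_congr fun n => ?_
        rw [ENNReal.tsum_mul_left, tsum_pi_prod (fun i j =>
          ENNReal.ofReal (levelWeight s j * blockWeight m j (freqBlock (n i))))]
    _ ≤ A * ∑' n : Fin d → ℤ, ‖F n‖ₑ ^ 2 *
          ∏ i, (κ * ENNReal.ofReal ((1 + (n i : ℝ) ^ 2) ^ s)) := by
        gcongr with n i _
        refine (tsum_levels_le hs hsm _).trans ?_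
        gcongr
        exact levelWeight_freqBlock_le hs _
    _ = _ := by
        rw [mainConst, mul_assoc, ← ENNReal.tsum_mul_left (a := κ ^ d)]
        congr 1
        refine tsum_congr fun n => ?_
        rw [Finset.prod_mul_distrib, Finset.prod_const, Finset.card_univ, Fintype.card_fin,
          mul_left_comm]

/-- The squared form of the estimate for Besov norms. -/
lemma level_coeff_le {d m : ℕ} {s : ℝ} (hs : 0 < s) (hsm : s < m) {S : ℝ} {γ δ : ℝ≥0}
    {ψ : ℝ → ℝ} (h2 : MemLp ψ 2 volume) (hS : HasSupport ψ S) (hm : HasVanishingMoments ψ m)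
    (hR : IsRieszOnLevels ψ γ δ) {f : UnitAddTorus (Fin d) → ℂ}
    (hf : MemLp f 2 (torusMeasure d)) (r : ℕ) (j : Level d) :
    ENNReal.ofReal ((2 : ℝ) ^ (2 * (levelNorm j.1 : ℝ) * s)) *
        ∑ k ∈ multiIdx j.1, ‖coeff ψ f j.1 k‖ₑ ^ 2 ≤
      mainConst d m s S δ * besovMixNorm r s f ^ 2 := by
  classical
  have hm0 : 0 < m := by exact_mod_cast hs.trans hsm
  set F := UnitAddTorus.mFourierCoeff f
  set A := ENNReal.ofReal (analysisConst m S δ ^ d) with hA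
  set κ := ENNReal.ofReal (∑' t, levelKernel m s t) with hκ
  set w : (Fin d → ℤ) → ℝ≥0∞ := fun b => ∏ i, ENNReal.ofReal (blockWeight m (j.1 i) (b i)) with hw
  set E : (Fin d → ℤ) → ℝ≥0∞ := fun b => ∑' n : Fin d → ℤ,
    (if (fun i => freqBlock (n i)) = b then ‖F n‖ₑ ^ 2 else 0) with hE
  -- Frequencies are sorted into dyadic boxes `b`, on which the weight is constant.
  have hsplit : ∑' n : Fin d → ℤ, ‖F n‖ₑ ^ 2 * w (fun i => freqBlock (n i)) =
      ∑' b, w b * E b := by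
    simp only [hE, ← ENNReal.tsum_mul_left, mul_ite, mul_zero]
    rw [ENNReal.tsum_comm]
    refine tsum_congr fun n => ?_
    rw [tsum_eq_single (fun i => freqBlock (n i)) (fun b hb => if_neg hb.symm), if_pos rfl,
      mul_comm]
  -- The factor `levelWeight s (b i)` and its inverse are inserted so that the Besov bound for a
  -- single box applies.
  have hterm : ∀ b : Fin d → ℤ, ENNReal.ofReal (∏ i, levelWeight s (j.1 i)) * (w b * E b) ≤
      (∏ i, ENNReal.ofReal (levelWeight s (j.1 i) * blockWeight m (j.1 i) (b i) *
        (levelWeight s (b i))⁻¹)) * besovMixNorm r s f ^ 2 := by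
    intro b
    refine le_trans (le_of_eq ?_) (mul_le_mul_right (levelWeight_mul_block_le hs hf b) _)
    rw [← mul_assoc, ← mul_assoc]
    congr 1
    rw [ENNReal.ofReal_prod_of_nonneg fun i _ => (levelWeight_pos _ _).le,
      ENNReal.ofReal_prod_of_nonneg fun i _ => (levelWeight_pos _ _).le, hw,
      ← Finset.prod_mul_distrib, ← Finset.prod_mul_distrib]
    refine Finset.prod_congr rfl fun i _ => ?_
    have h1 := (levelWeight_pos s (j.1 i)).le
    have h3 := levelWeight_pos s (b i)
    have h4 := blockWeight_nonneg m (j.1 i) (b i)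
    rw [← ENNReal.ofReal_mul h1, ← ENNReal.ofReal_mul (by positivity), mul_assoc (_ * _),
      inv_mul_cancel₀ h3.ne', mul_one]
  calc _ ≤ ENNReal.ofReal (∏ i, levelWeight s (j.1 i)) * (A * ∑' b, w b * E b) := by
        rw [← prod_levelWeight, ← hsplit]
        exact mul_le_mul_right (sum_sq_coeff_le hm0 h2 hS hm hR hf j) _
    _ = A * ∑' b, ENNReal.ofReal (∏ i, levelWeight s (j.1 i)) * (w b * E b) := by
        rw [mul_left_comm, ENNReal.tsum_mul_left]
    _ ≤ A * ∑' b : Fin d → ℤ, (∏ i, ENNReal.ofReal (levelWeight s (j.1 i) *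
          blockWeight m (j.1 i) (b i) * (levelWeight s (b i))⁻¹)) * besovMixNorm r s f ^ 2 := by
        exact mul_le_mul_right (ENNReal.tsum_le_tsum hterm) A
    _ = A * ((∏ i, ∑' n, ENNReal.ofReal (levelWeight s (j.1 i) *
          blockWeight m (j.1 i) n * (levelWeight s n)⁻¹)) * besovMixNorm r s f ^ 2) := by
        rw [ENNReal.tsum_mul_right, tsum_pi_prod (fun i n => ENNReal.ofReal (levelWeight s (j.1 i) *
          blockWeight m (j.1 i) n * (levelWeight s n)⁻¹))]
    _ ≤ A * (κ ^ d * besovMixNorm r s f ^ 2) := by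
        gcongr
        refine (Finset.prod_le_prod' fun i _ => tsum_blocks_le hs hsm (j.1 i)).trans (le_of_eq ?_)
        rw [Finset.prod_const, Finset.card_univ, Fintype.card_fin]
    _ = _ := by rw [mainConst, mul_assoc]

end PeriodicWavelet

end

open PeriodicWavelet in
theorem mainTheorem2 (d m : ℕ) (s : ℝ) (hs : 0 < s) (hsm : s < m) (S : ℝ) (δ : ℝ≥0) :
    ∃ C : ℝ≥0, ∀ (ψ : ℝ → ℝ) (γ : ℝ≥0), MemLp ψ 2 volume →
      HasSupport ψ S → HasVanishingMoments ψ m → IsRieszOnLevels ψ γ δ →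
      ∀ f : UnitAddTorus (Fin d) → ℂ, MemLp f 2 (torusMeasure d) →
        (∑' j : Level d, ENNReal.ofReal ((2 : ℝ) ^ (2 * (levelNorm j.1 : ℝ) * s)) *
            ∑ k ∈ multiIdx j.1, ‖coeff ψ f j.1 k‖ₑ ^ 2) ^ (1 / 2 : ℝ)
          ≤ (C : ℝ≥0∞) * sobolevMixNorm s f ∧
        ∀ r : ℕ, s < r →
          (⨆ j : Level d, ENNReal.ofReal ((2 : ℝ) ^ ((levelNorm j.1 : ℝ) * s)) *
            (∑ k ∈ multiIdx j.1, ‖coeff ψ f j.1 k‖ₑ ^ 2) ^ (1 / 2 : ℝ))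
          ≤ (C : ℝ≥0∞) * besovMixNorm r s f := by
  have htop : mainConst d m s S δ ≠ ∞ :=
    ENNReal.mul_ne_top ENNReal.ofReal_ne_top (ENNReal.pow_ne_top ENNReal.ofReal_ne_top)
  have hhalf : (0 : ℝ) ≤ 1 / 2 := by norm_num
  refine ⟨(mainConst d m s S δ ^ (1 / 2 : ℝ)).toNNReal, ?_⟩
  rw [ENNReal.coe_toNNReal (ENNReal.rpow_ne_top_of_nonneg hhalf htop)]
  intro ψ γ h2 hS hm hR f hf
  refine ⟨?_, fun r _ => iSup_le fun j => ?_⟩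
  · rw [sobolevMixNorm, ← ENNReal.mul_rpow_of_nonneg _ _ hhalf]
    exact ENNReal.rpow_le_rpow (tsum_levels_coeff_le hs hsm h2 hS hm hR hf) hhalf
  · have h1 : ENNReal.ofReal ((2 : ℝ) ^ ((levelNorm j.1 : ℝ) * s)) =
        ENNReal.ofReal ((2 : ℝ) ^ (2 * (levelNorm j.1 : ℝ) * s)) ^ (1 / 2 : ℝ) := by
      rw [ENNReal.ofReal_rpow_of_nonneg (by positivity) hhalf, ← Real.rpow_mul (by norm_num)]
      congr 2
      ring
    have h3 : besovMixNorm r s f = (besovMixNorm r s f ^ 2) ^ (1 / 2 : ℝ) := by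
      rw [← ENNReal.rpow_natCast, ← ENNReal.rpow_mul]
      norm_num
    rw [h1, h3, ← ENNReal.mul_rpow_of_nonneg _ _ hhalf, ← ENNReal.mul_rpow_of_nonneg _ _ hhalf]
    exact ENNReal.rpow_le_rpow (level_coeff_le hs hsm h2 hS hm hR hf r j) hhalf
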